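/- **Setting.** The computational model is the deterministic word RAM with $O(\log n)$-bit words: a program uses finitely many registers and finitely many arrays, memory outside the input is initially zero, every instruction takes one time step, and for some constant $c$ (depending on the program) every value computed on an input with $n$ nodes is less than $(n+2)^c$. *Combinatorial algorithms.* The notion "combinatorial algorithm" has no precise definition; the theorem is stated for every class of programs that is closed under elementary bookkeeping. Call a program *elementary* if it contains no loop, or if it is a single pass "for $i=0,\dots,b-1$ do $B$" where $B$ is loop-free and the iterations are independent of each other: $B$ does not change $i$ or $b$, the registers written by $B$ are reset to $0$ after each iteration, and no array is both read and written by $B$. For an arbitrary set $\mathcal B$ of programs let $\mathcal C(\mathcal B)$ be the smallest class of programs that contains $\mathcal B$ and contains, with each program $P$ and each elementary program $R$, the programs "$R;P$" and "$P;R$". (The classes $\mathcal C(\mathcal B)$ are exactly the classes closed under these two operations.) Fix $\mathcal B$; the programs in $\mathcal C=\mathcal C(\mathcal B)$ are called combinatorial. *Combinatorial $k$-Clique hypothesis.* For every integer $k\ge 3$ and every $\varepsilon>0$, no combinatorial algorithm decides in time $O(n^{k-\varepsilon})$ whether a given (undirected, simple) graph on $n\ge 1$ nodes, given by its adjacency matrix,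 contains a clique on $k$ nodes. *Dyck reachability.* The Dyck-$k$ language is the set of well-matched words over $k$ types of parentheses $a_1,\bar a_1,\dots,a_k,\bar a_k$, generated by the grammar $S\to\epsilon\mid SS\mid a_1S\bar a_1\mid\dots\mid a_kS\bar a_k$. The input is a nonempty directed graph $G=(V,E)$, $E\subseteq V\times V$, without isolated vertices, each of whose edges carries one of the $2k$ parentheses as its label, given as a list of its $m=|E|$ edges. A vertex $v$ is Dyck-$k$-reachable from $u$ if some path from $u$ to $v$, in which vertices and edges may repeat, has a sequence of labels that belongs to the Dyck-$k$ language. *On-Demand* Dyck-$k$ reachability: given $G$ and $u,v\in V$, decide whether $v$ is Dyck-$k$-reachable from $u$. *All-Pairs* Dyck-$k$ reachability: given $G$, compute (as a table indexed by $V\times V$) all pairs $(u,v)$ such that $v$ is Dyck-$k$-reachable from $u$. **Theorem.** Assume the combinatorial $k$-Clique hypothesis (for all $k\ge3$). Then for every integer $k\ge 2$ and every constant $\varepsilon>0$, no combinatorial algorithm solves On-Demand Dyck-$k$ reachability in time $O(m^{3-\varepsilon})$, and no combinatorial algorithm solves All-Pairs Dyck-$k$ reachability in time $O(m^{3-\varepsilon})$.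 -/

import Mathlib

/-! ### Word-RAM programs

A word RAM with finitely many registers and finitely many arrays, programmed in a structured
language.  Every instruction costs one unit of time.  `Exec B P s t s'` says that `P`, started in
memory `s`, halts after `t` steps in memory `s'` and every value it ever computes is less than `B`;
words of `O(log n)` bits are expressed by taking `B = (n + 2) ^ c` with a constant `c`. -/

/-- Contents of the memory: registers and arrays. -/
structure RamState where
  reg : ℕ → ℕ
  arr : ℕ → ℕ → ℕ

/-- An operand is a register or a constant. -/
inductive Operand where
  | reg (r : ℕ)
  | lit (c : ℕ)

/-- The value of an operand. -/
def Operand.val (s : RamState) : Operand → ℕ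
  | .reg r => s.reg r
  | .lit c => c

/-- The arithmetic and bitwise operations of the machine. -/
inductive WordOp where
  | add | sub | mul | div | mod | and | or | xor | shl | shr

/-- The meaning of the operations. -/
def WordOp.eval : WordOp → ℕ → ℕ → ℕ
  | .add, x, y => x + y
  | .sub, x, y => x - y
  | .mul, x, y => x * y
  | .div, x, y => x / y
  | .mod, x, y => x % y
  | .and, x, y => x &&& y
  | .or, x, y => x ||| y
  | .xor, x, y => x ^^^ y
  | .shl, x, y => x <<< y
  | .shr, x, y => x >>> y

/-- Programs. -/
inductive Prog where
  /-- do nothing -/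
  | skip
  /-- `r := x o y` -/
  | op (r : ℕ) (o : WordOp) (x y : Operand)
  /-- `r := A[x]` -/
  | load (r A : ℕ) (x : Operand)
  /-- `A[x] := y` -/
  | store (A : ℕ) (x y : Operand)
  /-- `P; Q` -/
  | seq (P Q : Prog)
  /-- `if x < y then P else Q` -/
  | ifLt (x y : Operand) (P Q : Prog)
  /-- `while x < y do P` -/
  | whileLt (x y : Operand) (P : Prog)

/-- Assign a value to a register. -/
def RamState.setReg (s : RamState) (r v : ℕ) : RamState :=
  { s with reg := Function.update s.reg r v }

/-- Assign a value to an array cell. -/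
def RamState.setArr (s : RamState) (A i v : ℕ) : RamState :=
  { s with arr := Function.update s.arr A (Function.update (s.arr A) i v) }

/-- `Exec B P s t s'`: from memory `s` the program `P` halts in `s'` after `t` steps, and every
value written on the way is less than `B`. -/
inductive Exec (B : ℕ) : Prog → RamState → ℕ → RamState → Prop where
  | skip (s : RamState) : Exec B .skip s 1 s
  | op (s : RamState) (r : ℕ) (o : WordOp) (x y : Operand)
      (h : o.eval (x.val s) (y.val s) < B) :
      Exec B (.op r o x y) s 1 (s.setReg r (o.eval (x.val s) (y.val s)))
  | load (s : RamState) (r A : ℕ) (x : Operand) (h : s.arr A (x.val s) < B) :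
      Exec B (.load r A x) s 1 (s.setReg r (s.arr A (x.val s)))
  | store (s : RamState) (A : ℕ) (x y : Operand) (hx : x.val s < B) (hy : y.val s < B) :
      Exec B (.store A x y) s 1 (s.setArr A (x.val s) (y.val s))
  | seq {P Q : Prog} {s s₁ s₂ : RamState} {t₁ t₂ : ℕ}
      (h₁ : Exec B P s t₁ s₁) (h₂ : Exec B Q s₁ t₂ s₂) :
      Exec B (.seq P Q) s (t₁ + t₂) s₂
  | ifTrue {x y : Operand} {P Q : Prog} {s s₁ : RamState} {t : ℕ}
      (h : x.val s < y.val s) (h₁ : Exec B P s t s₁) :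
      Exec B (.ifLt x y P Q) s (t + 1) s₁
  | ifFalse {x y : Operand} {P Q : Prog} {s s₁ : RamState} {t : ℕ}
      (h : ¬ x.val s < y.val s) (h₁ : Exec B Q s t s₁) :
      Exec B (.ifLt x y P Q) s (t + 1) s₁
  | whileTrue {x y : Operand} {P : Prog} {s s₁ s₂ : RamState} {t₁ t₂ : ℕ}
      (h : x.val s < y.val s) (h₁ : Exec B P s t₁ s₁)
      (h₂ : Exec B (.whileLt x y P) s₁ t₂ s₂) :
      Exec B (.whileLt x y P) s (t₁ + t₂ + 1) s₂
  | whileFalse {x y : Operand} {P : Prog} {s : RamState}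
      (h : ¬ x.val s < y.val s) :
      Exec B (.whileLt x y P) s 1 s

/-! ### Combinatorial algorithms

"Combinatorial algorithm" has no precise definition.  It is therefore treated relative to an
arbitrary set `base` of programs: the class generated from `base` consists of the programs of
`base` preceded and followed by elementary bookkeeping.  A class of programs is closed under
such bookkeeping if and only if it is the class that it generates, so a statement for all `base` is
a statement for all classes closed under elementary bookkeeping.

Elementary programs are kept so weak that they cannot hide an algebraic algorithm: they are
either loop-free, or a single pass `for i < b` over a loop-free body whose iterations are
independent of each other. -/

/-- The program contains no loop. -/
def Prog.LoopFree : Prog → Prop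
  | .skip => True
  | .op _ _ _ _ => True
  | .load _ _ _ => True
  | .store _ _ _ => True
  | .seq P Q => P.LoopFree ∧ Q.LoopFree
  | .ifLt _ _ P Q => P.LoopFree ∧ Q.LoopFree
  | .whileLt _ _ _ => False

/-- The registers that the program may assign to. -/
def Prog.writtenRegs : Prog → List ℕ
  | .skip => []
  | .op r _ _ _ => [r]
  | .load r _ _ => [r]
  | .store _ _ _ => []
  | .seq P Q => P.writtenRegs ++ Q.writtenRegs
  | .ifLt _ _ P Q => P.writtenRegs ++ Q.writtenRegs
  | .whileLt _ _ P => P.writtenRegs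

/-- The arrays that the program may read from. -/
def Prog.loadedArrs : Prog → List ℕ
  | .skip => []
  | .op _ _ _ _ => []
  | .load _ A _ => [A]
  | .store _ _ _ => []
  | .seq P Q => P.loadedArrs ++ Q.loadedArrs
  | .ifLt _ _ P Q => P.loadedArrs ++ Q.loadedArrs
  | .whileLt _ _ P => P.loadedArrs

/-- The arrays that the program may write to. -/
def Prog.storedArrs : Prog → List ℕ
  | .skip => []
  | .op _ _ _ _ => []
  | .load _ _ _ => []
  | .store A _ _ => [A]
  | .seq P Q => P.storedArrs ++ Q.storedArrs
  | .ifLt _ _ P Q => P.storedArrs ++ Q.storedArrs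
  | .whileLt _ _ P => P.storedArrs

/-- Reset the listed registers to zero. -/
def Prog.clear : List ℕ → Prog
  | [] => .skip
  | r :: l => .seq (.op r .add (.lit 0) (.lit 0)) (Prog.clear l)

/-- `for i = 0, …, b - 1 do body`, where after each iteration all registers used by the body are
reset to zero. -/
def Prog.forRange (i b : ℕ) (body : Prog) : Prog :=
  .seq (.op i .add (.lit 0) (.lit 0))
    (.whileLt (.reg i) (.reg b)
      (.seq body (.seq (Prog.clear body.writtenRegs) (.op i .add (.reg i) (.lit 1)))))

/-- Elementary programs: loop-free programs, and single passes with independent iterations.  The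
iterations are independent because the body passes nothing on in registers (those it writes are
reset) nor in arrays (no array is both read and written). -/
inductive Elementary : Prog → Prop where
  | loopFree {P : Prog} (h : P.LoopFree) : Elementary P
  | pass {i b : ℕ} {body : Prog} (h : body.LoopFree)
      (hib : i ≠ b) (hi : i ∉ body.writtenRegs) (hb : b ∉ body.writtenRegs)
      (harr : ∀ A ∈ body.loadedArrs, A ∉ body.storedArrs) :
      Elementary (Prog.forRange i b body)

/-- The class of algorithms generated by `base` under elementary pre- and postprocessing. -/
inductive Combinatorial (base : Set Prog) : Prog → Prop where
  | basic {P : Prog} (h : P ∈ base) : Combinatorial base P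
  | pre {R P : Prog} (hR : Elementary R) (hP : Combinatorial base P) :
      Combinatorial base (.seq R P)
  | post {P R : Prog} (hP : Combinatorial base P) (hR : Elementary R) :
      Combinatorial base (.seq P R)

/-! ### Clique detection -/

open Classical in
/-- The input for clique detection: register `0` holds the number `n` of nodes and array `0` the
adjacency matrix, row by row. All other cells are zero. -/
noncomputable def cliqueInput {n : ℕ} (G : SimpleGraph (Fin n)) : RamState where
  reg r := if r = 0 then n else 0
  arr A a := if A = 0 ∧ ∃ i j : Fin n, G.Adj i j ∧ a = (i : ℕ) * n + j then 1 else 0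

open Classical in
/-- `P` decides, on graphs with `n ≥ 1` nodes, with words of `O(log n)` bits and in time at most
`T n`, whether there is a clique of `k` nodes. The answer (`1` or `0`) is left in register `0`. -/
def DetectsClique (k : ℕ) (P : Prog) (T : ℕ → ℝ) : Prop :=
  ∃ c : ℕ, ∀ n : ℕ, 1 ≤ n → ∀ G : SimpleGraph (Fin n), ∃ (t : ℕ) (s : RamState),
    Exec ((n + 2) ^ c) P (cliqueInput G) t s ∧ (t : ℝ) ≤ T n ∧
      s.reg 0 = if ∃ K : Finset (Fin n), G.IsNClique k K then 1 else 0

/-- The `k`-Clique hypothesis for a class `𝒞` of algorithms: for no `k ≥ 3` and `ε > 0` does an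
algorithm in `𝒞` detect `k`-cliques in time `O(n ^ (k - ε))`. -/
def CliqueHypothesis (𝒞 : Prog → Prop) : Prop :=
  ∀ k : ℕ, 3 ≤ k → ∀ ε : ℝ, 0 < ε →
    ¬ ∃ P : Prog, 𝒞 P ∧ ∃ C : ℝ, DetectsClique k P fun n => C * (n : ℝ) ^ ((k : ℝ) - ε)

/-! ### Context-free reachability -/

/-- A nonempty directed graph on the vertices `0, …, n - 1` with edges labelled in `σ` and without
isolated vertices, given by the list of its edges (source, label, target). -/
structure LabelledGraph (σ : Type) where
  n : ℕ
  n_pos : 0 < n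
  edges : List (Fin n × σ × Fin n)
  simple : (edges.map fun e => (e.1, e.2.2)).Nodup
  no_isolated : ∀ v : Fin n, ∃ e ∈ edges, e.1 = v ∨ e.2.2 = v

/-- The number of edges. -/
def LabelledGraph.m {σ : Type} (G : LabelledGraph σ) : ℕ := G.edges.length

/-- `G.Walk u w v`: some path (vertices and edges may repeat) from `u` to `v` has the word `w` as
its sequence of labels. -/
inductive LabelledGraph.Walk {σ : Type} (G : LabelledGraph σ) :
    Fin G.n → List σ → Fin G.n → Prop where
  | nil (u : Fin G.n) : LabelledGraph.Walk G u [] u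
  | cons {u x v : Fin G.n} {a : σ} {w : List σ} (he : (u, a, x) ∈ G.edges)
      (hw : LabelledGraph.Walk G x w v) : LabelledGraph.Walk G u (a :: w) v

/-- `v` is `L`-reachable from `u`. -/
def LabelledGraph.Reachable {σ : Type} (G : LabelledGraph σ) (L : Language σ)
    (u v : Fin G.n) : Prop :=
  ∃ w ∈ L, G.Walk u w v

/-- The alphabet of `k` pairs of parentheses: `(j, true)` opens and `(j, false)` closes. -/
abbrev Paren (k : ℕ) : Type := Fin k × Bool

/-- The number that represents a parenthesis in memory. -/
def Paren.code {k : ℕ} (p : Paren k) : ℕ := 2 * (p.1 : ℕ) + if p.2 then 0 else 1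

/-- The rules of the Dyck grammar with `k` types of parentheses:
`S → ε`, `S → S S`, and `S → a_j S ā_j` for each `j`. -/
def dyckRules (k : ℕ) : Finset (ContextFreeRule (Paren k) Unit) :=
  {⟨(), []⟩, ⟨(), [.nonterminal (), .nonterminal ()]⟩} ∪
    Finset.univ.image fun j : Fin k =>
      ⟨(), [.terminal (j, true), .nonterminal (), .terminal (j, false)]⟩

/-- The Dyck grammar with `k` types of parentheses; it generates the well-matched words. -/
def dyckGrammar (k : ℕ) : ContextFreeGrammar (Paren k) where
  NT := Unit
  initial := ()
  rules := dyckRules k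

/-- The memory that presents a graph: registers `0` and `1` hold the numbers of vertices and of
edges, arrays `1`, `2`, `3` the sources, labels and targets of the edges; registers `2` and `3` hold
the two numbers `x` and `y`. All other cells are zero. -/
def graphInput {k : ℕ} (G : LabelledGraph (Paren k)) (x y : ℕ) : RamState where
  reg r := if r = 0 then G.n else if r = 1 then G.m else
    if r = 2 then x else if r = 3 then y else 0
  arr A i :=
    match G.edges[i]? with
    | none => 0
    | some e => if A = 1 then (e.1 : ℕ) else if A = 2 then Paren.code e.2.1 else
        if A = 3 then (e.2.2 : ℕ) else 0

open Classical in
/-- `P` solves the on-demand Dyck-`k` reachability problem, with words of `O(log n)` bits and in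
time at most `T m`: given a graph and vertices `u`, `v`, it leaves in register `0` the answer
(`1` or `0`) to whether `v` is Dyck-`k`-reachable from `u`. -/
def SolvesOnDemandDyck (k : ℕ) (P : Prog) (T : ℕ → ℝ) : Prop :=
  ∃ c : ℕ, ∀ (G : LabelledGraph (Paren k)) (u v : Fin G.n), ∃ (t : ℕ) (s : RamState),
    Exec ((G.n + 2) ^ c) P (graphInput G u v) t s ∧ (t : ℝ) ≤ T G.m ∧
      s.reg 0 = if G.Reachable (dyckGrammar k).language u v then 1 else 0

open Classical in
/-- `P` solves the all-pairs Dyck-`k` reachability problem, with words of `O(log n)` bits and in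
time at most `T m`: given a graph, it leaves in array `4` the table (row by row, with entries
`1` and `0`) of the pairs `(u, v)` such that `v` is Dyck-`k`-reachable from `u`. -/
def SolvesAllPairsDyck (k : ℕ) (P : Prog) (T : ℕ → ℝ) : Prop :=
  ∃ c : ℕ, ∀ G : LabelledGraph (Paren k), ∃ (t : ℕ) (s : RamState),
    Exec ((G.n + 2) ^ c) P (graphInput G 0 0) t s ∧ (t : ℝ) ≤ T G.m ∧
      ∀ u v : Fin G.n, s.arr 4 ((u : ℕ) * G.n + v) =
        if G.Reachable (dyckGrammar k).language u v then 1 else 0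

/-!
A fast algorithm for Dyck reachability would find cliques of `3 * K` nodes too fast, for a large
constant `K`. Number the `K`-tuples of nodes of a graph `G` with `n` nodes by `t < n ^ K`, and read
the word along a path as the moves of a stack: an opening parenthesis pushes its type and a closing
one pops it. A word is well matched exactly if it takes the empty stack to the empty stack
(`mem_dyck_iff`). Build a graph whose paths from source to target have three phases. In each phase
the path selects a tuple whose entries form a clique and runs through the gadget of this tuple:

* the gadget of `x`, in the first phase, pushes the code of `x` twice;
* the gadget of `y`, in the second phase, pops one copy of the code of `x`, checking that each entry
  popped is adjacent to all entries of `y`, and pushes the code of `y`;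
* the gadget of `z`, in the third phase, pops the codes of `y` and `x` with the same check.

All paths pass through the same vertices between the phases, so the stack is the only memory, and
the number of edges is `O(n ^ (K + 1))` instead of the `n ^ (2 * K)` pairs of tuples. A node `e` is
coded in unary as `a ^ e b`, which a row of `n` vertices can push or pop. The target is reachable
from the source exactly if `x`, `y`, `z` together form a clique of `3 * K` nodes
(`accepts_source_iff`, `accepts_iff_exists_isNClique`). An algorithm with running time
`O(m ^ (3 - ε))` then needs time `O(n ^ ((K + 1) * (3 - ε)))`, which is at most `O(n ^ (3 * K - 1))`
once `ε * (K + 1) ≥ 4` (`time_bound`).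

The graph has to be built by elementary programs. Every vertex is given exactly two outgoing edges,
the superfluous ones leading to dead ends, so that source, label and target of the edge number `i`
are computed from `i` and the adjacency matrix in constant time (`Expressible.edgeLab`,
`Expressible.edgeTgt`). Expressions are compiled to loop-free programs (`Expr.exec_compile`); one
pass fills each of the three arrays, and a last one erases the adjacency matrix (`exec_onGraph`).
-/

/-! ### The Dyck language and stacks -/

/-- `Closes w st`: reading the word `w`, where an opening parenthesis pushes its type and a closing
one pops it, empties the stack `st` (whose top is the head of the list). -/
inductive Closes {k : ℕ} : List (Paren k) → List ℕ → Prop where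
  | nil : Closes [] []
  | push {j : Fin k} {w : List (Paren k)} {st : List ℕ} (h : Closes w ((j : ℕ) :: st)) :
      Closes ((j, true) :: w) st
  | pop {j : Fin k} {w : List (Paren k)} {st : List ℕ} (h : Closes w st) :
      Closes ((j, false) :: w) ((j : ℕ) :: st)

theorem Closes.insert_pair {k : ℕ} (j : Fin k) (w' : List (Paren k)) :
    ∀ (w : List (Paren k)) (st : List ℕ), Closes (w ++ w') st →
      Closes (w ++ ((j, true) :: (j, false) :: w')) st
  | [], _, h => .push (.pop h)
  | _ :: w, _, h => by
    cases h with
    | push h => exact .push (insert_pair j w' w _ h)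
    | pop h => exact .pop (insert_pair j w' w _ h)

/-- The terminals of a sentential form. -/
def terminals {T N : Type} : List (Symbol T N) → List T
  | [] => []
  | .terminal t :: l => t :: terminals l
  | .nonterminal _ :: l => terminals l

theorem terminals_append {T N : Type} : ∀ l l' : List (Symbol T N),
    terminals (l ++ l') = terminals l ++ terminals l'
  | [], _ => rfl
  | .terminal t :: l, l' => congrArg (t :: ·) (terminals_append l l')
  | .nonterminal _ :: l, l' => terminals_append l l'

theorem terminals_map {T N : Type} : ∀ w : List T,
    terminals (w.map (Symbol.terminal (N := N))) = w
  | [] => rfl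
  | t :: w => congrArg (t :: ·) (terminals_map w)

theorem mem_dyckRules {k : ℕ} {r : ContextFreeRule (Paren k) Unit} :
    r ∈ dyckRules k ↔ r = ⟨(), []⟩ ∨ r = ⟨(), [.nonterminal (), .nonterminal ()]⟩ ∨
      ∃ j : Fin k, r = ⟨(), [.terminal (j, true), .nonterminal (), .terminal (j, false)]⟩ := by
  unfold dyckRules
  simp only [Finset.mem_union, Finset.mem_insert, Finset.mem_singleton, Finset.mem_image,
    Finset.mem_univ, true_and, or_assoc, @eq_comm _ r]

/-- Each rule of the Dyck grammar leaves the terminals of a sentential form unchanged or inserts a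
matched pair among them. -/
theorem closes_terminals {k : ℕ} {u : List (Symbol (Paren k) (dyckGrammar k).NT)}
    (h : (dyckGrammar k).Generates u) : Closes (terminals u) [] := by
  induction h with
  | refl => exact .nil
  | tail _ h ih =>
    obtain ⟨r, hr, hrw⟩ := h
    obtain ⟨p, q, rfl, rfl⟩ := hrw.exists_parts
    rw [terminals_append, terminals_append] at ih ⊢
    rcases mem_dyckRules.1 hr with rfl | rfl | ⟨j, rfl⟩
    · exact ih
    · exact ih
    · have h : Closes (terminals p ++ terminals q) [] := by
        rwa [← List.append_nil (terminals p)]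
      have := h.insert_pair j
      rw [List.append_assoc]
      exact this

theorem dyck_produces {k : ℕ} {l : List (Symbol (Paren k) Unit)}
    (h : (⟨(), l⟩ : ContextFreeRule (Paren k) Unit) ∈ dyckRules k) :
    (dyckGrammar k).Derives [.nonterminal ()] l :=
  .single ⟨⟨(), l⟩, h, ContextFreeRule.rewrites_iff.2 ⟨[], [], rfl, (List.append_nil l).symm⟩⟩

theorem dyck_nil (k : ℕ) : [] ∈ (dyckGrammar k).language :=
  dyck_produces (mem_dyckRules.2 (.inl rfl))

theorem dyck_append {k : ℕ} {w w' : List (Paren k)} (h : w ∈ (dyckGrammar k).language)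
    (h' : w' ∈ (dyckGrammar k).language) : w ++ w' ∈ (dyckGrammar k).language := by
  have h₀ : (dyckGrammar k).Derives [.nonterminal ()] [.nonterminal (), .nonterminal ()] :=
    dyck_produces (mem_dyckRules.2 (.inr (.inl rfl)))
  have h₁ := ContextFreeGrammar.Derives.append_right h [Symbol.nonterminal ()]
  have h₂ := ContextFreeGrammar.Derives.append_left h' (w.map Symbol.terminal)
  rw [ContextFreeGrammar.mem_language_iff, List.map_append]
  exact h₀.trans (h₁.trans h₂)

theorem dyck_wrap {k : ℕ} (j : Fin k) {w : List (Paren k)}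
    (h : w ∈ (dyckGrammar k).language) :
    (j, true) :: w ++ [(j, false)] ∈ (dyckGrammar k).language := by
  have h₀ : (dyckGrammar k).Derives [.nonterminal ()]
      [.terminal (j, true), .nonterminal (), .terminal (j, false)] :=
    dyck_produces (mem_dyckRules.2 (.inr (.inr ⟨j, rfl⟩)))
  have h₁ := ContextFreeGrammar.Derives.append_right
    (ContextFreeGrammar.Derives.append_left h [Symbol.terminal (j, true)])
    [Symbol.terminal (j, false)]
  rw [ContextFreeGrammar.mem_language_iff, List.map_append]
  exact h₀.trans h₁

/-- `Unwinds w st`: the word `w` is an interleaving of Dyck words with the closing parentheses of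
the stack `st`. -/
def Unwinds {k : ℕ} : List (Paren k) → List ℕ → Prop
  | w, [] => w ∈ (dyckGrammar k).language
  | w, c :: st => ∃ w₀ w₁ : List (Paren k), ∃ j : Fin k, (j : ℕ) = c ∧
      w = w₀ ++ (j, false) :: w₁ ∧ w₀ ∈ (dyckGrammar k).language ∧ Unwinds w₁ st

theorem Unwinds.append {k : ℕ} {w w' : List (Paren k)} {st : List ℕ}
    (h : w ∈ (dyckGrammar k).language) (h' : Unwinds w' st) : Unwinds (w ++ w') st := by
  cases st with
  | nil => exact dyck_append h h'
  | cons c st =>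
    obtain ⟨w₀, w₁, j, hj, rfl, h₀, h₁⟩ := h'
    exact ⟨w ++ w₀, w₁, j, hj, by simp, dyck_append h h₀, h₁⟩

theorem Closes.unwinds {k : ℕ} {w : List (Paren k)} {st : List ℕ} (h : Closes w st) :
    Unwinds w st := by
  induction h with
  | nil => exact dyck_nil k
  | @push j w st h ih =>
    obtain ⟨w₀, w₁, j', hj, rfl, h₀, h₁⟩ := ih
    obtain rfl : j' = j := Fin.ext hj
    simpa using Unwinds.append (dyck_wrap j' h₀) h₁
  | @pop j w st h ih => exact ⟨[], w, j, rfl, rfl, dyck_nil k, ih⟩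

/-- A word is well matched exactly if it takes the empty stack to the empty stack. -/
theorem mem_dyck_iff {k : ℕ} {w : List (Paren k)} :
    w ∈ (dyckGrammar k).language ↔ Closes w [] := by
  refine ⟨fun h => ?_, fun h => h.unwinds⟩
  have := closes_terminals h
  rwa [terminals_map] at this

/-! ### Graphs with two edges out of every vertex -/

/-- The parenthesis with a given number. -/
def Paren.decode {k : ℕ} (c : ℕ) (h : c < 2 * k) : Paren k :=
  (⟨c / 2, by omega⟩, decide (c % 2 = 0))

theorem Paren.code_decode {k : ℕ} (c : ℕ) (h : c < 2 * k) : (Paren.decode c h).code = c := by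
  by_cases h : c % 2 = 0 <;> simp [Paren.decode, Paren.code, h] <;> omega

/-- Labels and targets of the edges of a graph on the vertices `0, …, nv - 1` in which every vertex
`w` is the source of exactly two edges, the edges number `2 * w` and `2 * w + 1`. Labels are given by
the numbers of the parentheses. -/
structure TwoOut (k : ℕ) where
  nv : ℕ
  lab : ℕ → ℕ
  tgt : ℕ → ℕ
  one_lt : 1 < nv
  lab_lt : ∀ i < 2 * nv, lab i < 2 * k
  tgt_lt : ∀ i < 2 * nv, tgt i < nv
  tgt_ne : ∀ w < nv, tgt (2 * w) ≠ tgt (2 * w + 1)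

/-- The labelled graph given by the edge functions. -/
def TwoOut.graph {k : ℕ} (D : TwoOut k) : LabelledGraph (Paren k) where
  n := D.nv
  n_pos := by have := D.one_lt; omega
  edges := List.ofFn fun i : Fin (2 * D.nv) =>
    (⟨i / 2, by omega⟩, Paren.decode (D.lab i) (D.lab_lt i i.2), ⟨D.tgt i, D.tgt_lt i i.2⟩)
  simple := by
    rw [List.map_ofFn, List.nodup_ofFn]
    intro i j h
    simp only [Function.comp_apply, Prod.mk.injEq, Fin.mk.injEq] at h
    obtain ⟨h, h'⟩ := h
    have h₁ := D.tgt_ne (i / 2) (by omega)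
    rcases Nat.mod_two_eq_zero_or_one i with hi | hi <;>
      rcases Nat.mod_two_eq_zero_or_one j with hj | hj
    · exact Fin.ext (by omega)
    · rw [show 2 * ((i : ℕ) / 2) = i by omega, show (i : ℕ) + 1 = j by omega] at h₁
      exact absurd h' h₁
    · rw [show 2 * ((i : ℕ) / 2) = j by omega, show (j : ℕ) + 1 = i by omega] at h₁
      exact absurd h'.symm h₁
    · exact Fin.ext (by omega)
  no_isolated v := by
    refine ⟨_, List.mem_ofFn.2 ⟨⟨2 * v, by omega⟩, rfl⟩, .inl ?_⟩
    exact Fin.ext (by simp)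

theorem TwoOut.graph_m {k : ℕ} (D : TwoOut k) : D.graph.m = 2 * D.nv := by
  simp [LabelledGraph.m, TwoOut.graph]

theorem TwoOut.mem_edges {k : ℕ} (D : TwoOut k) {u v : Fin D.graph.n} {p : Paren k} :
    (u, p, v) ∈ D.graph.edges ↔ ∃ b < 2, D.lab (2 * u + b) = p.code ∧ D.tgt (2 * u + b) = v := by
  have hu : (u : ℕ) < D.nv := u.2
  have hinj : ∀ p q : Paren k, p.code = q.code → p = q := by
    rintro ⟨a, x⟩ ⟨b, y⟩ h
    cases x <;> cases y <;> simp [Paren.code] at h ⊢ <;> first | exact Fin.ext h | omega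
  refine Iff.trans (List.mem_ofFn (n := 2 * D.nv)) ⟨?_, ?_⟩
  · rintro ⟨i, hi⟩
    cases hi
    refine ⟨i % 2, by omega, ?_⟩
    simp only [Paren.code_decode]
    rw [show 2 * ((i : ℕ) / 2) + i % 2 = i by omega]
    exact ⟨rfl, rfl⟩
  · rintro ⟨b, hb, hl, ht⟩
    refine ⟨⟨2 * u + b, by omega⟩, Prod.ext (Fin.ext ?_) (Prod.ext (hinj _ _ ?_) (Fin.ext ht))⟩
    · show (2 * (u : ℕ) + b) / 2 = u
      omega
    · rw [Paren.code_decode, hl]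

/-- `D.Accepts w st`: along some path from `w` to the vertex `1` the stack `st` is emptied. -/
inductive TwoOut.Accepts {k : ℕ} (D : TwoOut k) : ℕ → List ℕ → Prop where
  | done : D.Accepts 1 []
  | push {w b c : ℕ} {st : List ℕ} (hb : b < 2) (hl : D.lab (2 * w + b) = 2 * c)
      (h : D.Accepts (D.tgt (2 * w + b)) (c :: st)) : D.Accepts w st
  | pop {w b c : ℕ} {st : List ℕ} (hb : b < 2) (hl : D.lab (2 * w + b) = 2 * c + 1)
      (h : D.Accepts (D.tgt (2 * w + b)) st) : D.Accepts w (c :: st)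

/-- Reachability with a Dyck word is acceptance with the empty stack. -/
theorem TwoOut.reachable_iff {k : ℕ} (D : TwoOut k) (u v : Fin D.graph.n) (hv : (v : ℕ) = 1) :
    D.graph.Reachable (dyckGrammar k).language u v ↔ D.Accepts u [] := by
  constructor
  · rintro ⟨w, hw, hwalk⟩
    rw [mem_dyck_iff] at hw
    generalize ([] : List ℕ) = st at hw
    induction hwalk generalizing st with
    | nil u => cases hw; rw [hv]; exact .done
    | cons he _ ih =>
      obtain ⟨b, hb, hl, ht⟩ := D.mem_edges.1 he
      cases hw with
      | push h => exact .push hb (by simpa [Paren.code] using hl) (ht ▸ ih hv _ h)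
      | pop h => exact .pop hb (by simpa [Paren.code] using hl) (ht ▸ ih hv _ h)
  · intro h
    suffices ∀ w st, D.Accepts w st → ∀ hw : w < D.graph.n,
        ∃ x, Closes x st ∧ D.graph.Walk ⟨w, hw⟩ x v by
      obtain ⟨x, hx, h'⟩ := this _ _ h u.2
      exact ⟨x, mem_dyck_iff.2 hx, h'⟩
    intro w st h
    induction h with
    | done =>
      intro hw
      obtain rfl : v = ⟨1, hw⟩ := Fin.ext hv
      exact ⟨[], .nil, .nil _⟩
    | @push w b c st hb hl h ih =>
      intro hw
      have hw' : w < D.nv := hw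
      have hi : 2 * w + b < 2 * D.nv := by omega
      obtain ⟨x, hx, hwalk⟩ := ih (D.tgt_lt _ hi)
      have hc : c < k := by have := D.lab_lt _ hi; omega
      refine ⟨(⟨c, hc⟩, true) :: x, .push hx, .cons (D.mem_edges.2 ⟨b, hb, ?_, rfl⟩) hwalk⟩
      simpa [Paren.code] using hl
    | @pop w b c st hb hl h ih =>
      intro hw
      have hw' : w < D.nv := hw
      have hi : 2 * w + b < 2 * D.nv := by omega
      obtain ⟨x, hx, hwalk⟩ := ih (D.tgt_lt _ hi)
      have hc : c < k := by have := D.lab_lt _ hi; omega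
      refine ⟨(⟨c, hc⟩, false) :: x, .pop (j := ⟨c, hc⟩) hx,
        .cons (D.mem_edges.2 ⟨b, hb, ?_, rfl⟩) hwalk⟩
      simpa [Paren.code] using hl

/-- Acceptance after following the edge number `e` with the stack `st`. -/
def TwoOut.Via {k : ℕ} (D : TwoOut k) (e : ℕ) (st : List ℕ) : Prop :=
  (∃ c, D.lab e = 2 * c ∧ D.Accepts (D.tgt e) (c :: st)) ∨
    ∃ c st', D.lab e = 2 * c + 1 ∧ st = c :: st' ∧ D.Accepts (D.tgt e) st'

theorem TwoOut.accepts_iff {k : ℕ} (D : TwoOut k) {w : ℕ} {st : List ℕ} :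
    D.Accepts w st ↔ (w = 1 ∧ st = []) ∨ D.Via (2 * w) st ∨ D.Via (2 * w + 1) st := by
  constructor
  · intro h
    cases h with
    | done => exact .inl ⟨rfl, rfl⟩
    | @push _ b c _ hb hl h =>
      have : b = 0 ∨ b = 1 := by omega
      rcases this with rfl | rfl
      · exact .inr (.inl (.inl ⟨c, hl, h⟩))
      · exact .inr (.inr (.inl ⟨c, hl, h⟩))
    | @pop _ b c st hb hl h =>
      have : b = 0 ∨ b = 1 := by omega
      rcases this with rfl | rfl
      · exact .inr (.inl (.inr ⟨c, st, hl, rfl, h⟩))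
      · exact .inr (.inr (.inr ⟨c, st, hl, rfl, h⟩))
  · rintro (⟨rfl, rfl⟩ | (⟨c, hl, h⟩ | ⟨c, st, hl, rfl, h⟩) | (⟨c, hl, h⟩ | ⟨c, st, hl, rfl, h⟩))
    · exact .done
    · exact .push (b := 0) (by omega) hl h
    · exact .pop (b := 0) (by omega) hl h
    · exact .push (b := 1) (by omega) hl h
    · exact .pop (b := 1) (by omega) hl h

theorem TwoOut.via_push {k : ℕ} (D : TwoOut k) {e c w : ℕ} {st : List ℕ} (hl : D.lab e = 2 * c)
    (ht : D.tgt e = w) : D.Via e st ↔ D.Accepts w (c :: st) := by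
  constructor
  · rintro (⟨c', hl', h⟩ | ⟨c', st, hl', rfl, h⟩)
    · obtain rfl : c = c' := by omega
      rwa [← ht]
    · omega
  · exact fun h => .inl ⟨c, hl, by rwa [ht]⟩

theorem TwoOut.via_pop {k : ℕ} (D : TwoOut k) {e c w d : ℕ} {st : List ℕ}
    (hl : D.lab e = 2 * c + 1) (ht : D.tgt e = w) :
    D.Via e (d :: st) ↔ d = c ∧ D.Accepts w st := by
  constructor
  · rintro (⟨c', hl', h⟩ | ⟨c', st, hl', h', h⟩)
    · omega
    · obtain rfl : c = c' := by omega
      cases h'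
      exact ⟨rfl, by rwa [← ht]⟩
  · rintro ⟨rfl, h⟩
    exact .inr ⟨d, st, hl, rfl, by rwa [ht]⟩

/-- No path leaves a set of vertices that is closed under the edges. -/
theorem TwoOut.not_accepts {k : ℕ} (D : TwoOut k) {X : Set ℕ} (h1 : 1 ∉ X)
    (hX : ∀ w ∈ X, ∀ b < 2, D.tgt (2 * w + b) ∈ X) {w : ℕ} (hw : w ∈ X) (st : List ℕ) :
    ¬ D.Accepts w st := by
  intro h
  induction h with
  | done => exact h1 hw
  | push hb _ _ ih => exact ih (hX _ hw _ hb)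
  | pop hb _ _ ih => exact ih (hX _ hw _ hb)

theorem TwoOut.not_via {k : ℕ} (D : TwoOut k) {e : ℕ} (h : ∀ st, ¬ D.Accepts (D.tgt e) st)
    (st : List ℕ) : ¬ D.Via e st := by
  rintro (⟨c, _, h'⟩ | ⟨c, st, _, _, h'⟩) <;> exact h _ h'

/-! ### The graph of the reduction -/

/-- The `j`-th entry of the tuple number `t` over `0, …, n - 1`. -/
def digit (n t j : ℕ) : ℕ := t / n ^ j % n

/-- For the adjacency matrix `A` (row by row): `1` if the entries of the `K`-tuple `t` are pairwise
adjacent, and `0` otherwise. -/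
def isCliqueNum (n K : ℕ) (A : ℕ → ℕ) (t : ℕ) : ℕ :=
  ∏ j ∈ Finset.range K, ∏ i ∈ Finset.range j, A (digit n t i * n + digit n t j)

/-- For the adjacency matrix `A`: `1` if all entries of the `K`-tuple `t` are adjacent to the
node `p`, and `0` otherwise. -/
def adjAllNum (n K : ℕ) (A : ℕ → ℕ) (t p : ℕ) : ℕ :=
  ∏ j ∈ Finset.range K, A (digit n t j * n + p)

/-- The number of vertices of the gadget of one tuple. -/
def width (n K : ℕ) : ℕ := 2 * K * n + 3

/-- The vertex number `q` of the gadget of the `K`-tuple `t` in phase `f`. The first four vertices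
of the graph are reserved for the source, the target and two dead ends. -/
def addr (n K f t q : ℕ) : ℕ := 4 + (f * n ^ K + t) * width n K + q

/-- The label of the edge number `b` out of the vertex number `q` of a gadget in phase `f`. The
numbers `0`, `1`, `2`, `3` stand for `a`, `ā`, `b`, `b̄`. -/
def gadgetLab (n K f q b : ℕ) : ℕ :=
  if q < 1 then 0 else if q < 2 then 1
  else if q + 1 < width n K then
    if (q - 2) / n / K < f then if b < 1 then 1 else 3
    else if (q - 2) % n < 1 then 2 else 0
  else if f < 2 then 0 else 3

/-- The target of the edge number `b` out of the vertex number `q` of the gadget of the tuple `t`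
in phase `f`. Vertices `0` and `1` serve to select the tuple; the last vertex leads to the next
phase. In between there are two blocks, block number `(q - 2) / n / K` popping a tuple if it is
below `f` and pushing the tuple `t` otherwise. -/
def gadgetTgt (n K : ℕ) (A : ℕ → ℕ) (f t q b : ℕ) : ℕ :=
  if q < 1 then if b < 1 then addr n K f t 1 else 3
  else if q < 2 then
    if b < 1 then if t + 1 < n ^ K then addr n K f (t + 1) 0 else 2
    else if 0 < isCliqueNum n K A t then addr n K f t 2 else 3
  else if q + 1 < width n K then
    if (q - 2) / n / K < f then
      if b < 1 then if (q - 2) % n + 1 < n then addr n K f t (q + 1) else 2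
      else if 0 < adjAllNum n K A t ((q - 2) % n) then addr n K f t (q - (q - 2) % n + n) else 3
    else if b < 1 then
      addr n K f t
        (if (q - 2) % n < 1 then q + (n - digit n t ((q - 2) / n % K)) else q + 1)
    else 3
  else if b < 1 then if f < 2 then addr n K (f + 1) 0 1 else 1
  else 3

/-- The number of vertices. -/
def numVerts (n K : ℕ) : ℕ := 4 + 3 * n ^ K * width n K

/-- The label of the edge number `i`. -/
def edgeLab (n K i : ℕ) : ℕ :=
  if i / 2 < 4 then if i / 2 < 1 then 2 else 0
  else gadgetLab n K ((i / 2 - 4) / width n K / n ^ K) ((i / 2 - 4) % width n K) (i % 2)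

/-- The target of the edge number `i`. -/
def edgeTgt (n K : ℕ) (A : ℕ → ℕ) (i : ℕ) : ℕ :=
  if i / 2 < 4 then if i % 2 < 1 then if i / 2 < 1 then 4 else 2 else 3
  else gadgetTgt n K A ((i / 2 - 4) / width n K / n ^ K) ((i / 2 - 4) / width n K % n ^ K)
    ((i / 2 - 4) % width n K) (i % 2)

theorem addr_lt {n K f t q : ℕ} (hf : f < 3) (ht : t < n ^ K) (hq : q < width n K) :
    addr n K f t q < numVerts n K := by
  unfold addr numVerts
  have h₁ : f * n ^ K + t + 1 ≤ 3 * n ^ K := by nlinarith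
  have h₂ := Nat.mul_le_mul_right (width n K) h₁
  rw [Nat.add_mul _ 1] at h₂
  omega

theorem addr_decode {n K f t q b : ℕ} (ht : t < n ^ K) (hq : q < width n K) (hb : b < 2) :
    (2 * addr n K f t q + b) % 2 = b ∧ ¬ (2 * addr n K f t q + b) / 2 < 4 ∧
    ((2 * addr n K f t q + b) / 2 - 4) % width n K = q ∧
    ((2 * addr n K f t q + b) / 2 - 4) / width n K / n ^ K = f ∧
    ((2 * addr n K f t q + b) / 2 - 4) / width n K % n ^ K = t := by
  have h₁ : (2 * addr n K f t q + b) / 2 = addr n K f t q := by omega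
  have h₂ : addr n K f t q - 4 = q + width n K * (f * n ^ K + t) := by
    unfold addr; rw [Nat.mul_comm (width n K)]; omega
  have h₃ : (q + width n K * (f * n ^ K + t)) / width n K = t + n ^ K * f := by
    rw [Nat.add_mul_div_left _ _ (by omega), Nat.div_eq_of_lt hq]; ring
  refine ⟨by omega, by rw [h₁]; unfold addr; omega, ?_, ?_, ?_⟩
  · rw [h₁, h₂, Nat.add_mul_mod_self_left, Nat.mod_eq_of_lt hq]
  · rw [h₁, h₂, h₃, Nat.add_mul_div_left _ _ (by omega), Nat.div_eq_of_lt ht, Nat.zero_add]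
  · rw [h₁, h₂, h₃, Nat.add_mul_mod_self_left, Nat.mod_eq_of_lt ht]

theorem exists_addr {n K w : ℕ} (hw : ¬ w < 4) (hw' : w < numVerts n K) :
    ∃ f < 3, ∃ t < n ^ K, ∃ q < width n K, w = addr n K f t q := by
  unfold numVerts at hw'
  have hS : 0 < width n K := by unfold width; omega
  have h₁ : (w - 4) / width n K < 3 * n ^ K := (Nat.div_lt_iff_lt_mul hS).2 (by omega)
  have hN : 0 < n ^ K := by
    by_contra h
    simp only [Nat.not_lt, Nat.le_zero] at h
    simp only [h, Nat.mul_zero, Nat.zero_mul] at hw'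
    omega
  refine ⟨(w - 4) / width n K / n ^ K, (Nat.div_lt_iff_lt_mul hN).2 h₁, _,
    Nat.mod_lt ((w - 4) / width n K) hN, _, Nat.mod_lt (w - 4) hS, ?_⟩
  have h₂ := Nat.div_add_mod' ((w - 4) / width n K) (n ^ K)
  have h₃ := Nat.div_add_mod' (w - 4) (width n K)
  unfold addr
  rw [h₂]
  omega

theorem edgeLab_addr {n K f t q b : ℕ} (ht : t < n ^ K) (hq : q < width n K) (hb : b < 2) :
    edgeLab n K (2 * addr n K f t q + b) = gadgetLab n K f q b := by
  obtain ⟨h₁, h₂, h₃, h₄, -⟩ := addr_decode (f := f) ht hq hb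
  rw [edgeLab, if_neg h₂, h₁, h₃, h₄]

theorem edgeTgt_addr {n K f t q b : ℕ} (A : ℕ → ℕ) (ht : t < n ^ K) (hq : q < width n K)
    (hb : b < 2) :
    edgeTgt n K A (2 * addr n K f t q + b) = gadgetTgt n K A f t q b := by
  obtain ⟨h₁, h₂, h₃, h₄, h₅⟩ := addr_decode (f := f) ht hq hb
  rw [edgeTgt, if_neg h₂, h₁, h₃, h₄, h₅]

theorem edgeLab_lt (n K i : ℕ) : edgeLab n K i < 4 := by
  unfold edgeLab gadgetLab
  split_ifs <;> omega

/-- A vertex strictly inside a gadget lies in one of two blocks of `K` rows of length `n`. -/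
theorem exists_row {n K q : ℕ} (hn : 0 < n) (hK : 0 < K) (hq : ¬ q < 2)
    (hq' : q + 1 < width n K) :
    ∃ r < n, ∃ j < K, ∃ g < 2, q = 2 + (g * K + j) * n + r := by
  unfold width at hq'
  have h₁ : (q - 2) / n < 2 * K := (Nat.div_lt_iff_lt_mul hn).2 (by omega)
  refine ⟨(q - 2) % n, Nat.mod_lt _ hn, (q - 2) / n % K, Nat.mod_lt _ hK, (q - 2) / n / K,
    (Nat.div_lt_iff_lt_mul hK).2 h₁, ?_⟩
  have h₂ := Nat.div_add_mod' ((q - 2) / n) K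
  have h₃ := Nat.div_add_mod' (q - 2) n
  rw [h₂]
  omega

theorem row_decode {n K g j r : ℕ} (hr : r < n) (hj : j < K) (hg : g < 2) :
    (2 + (g * K + j) * n + r - 2) % n = r ∧ (2 + (g * K + j) * n + r - 2) / n / K = g ∧
    (2 + (g * K + j) * n + r - 2) / n % K = j ∧
    2 + (g * K + j) * n + n + 1 ≤ width n K := by
  have h₁ : 2 + (g * K + j) * n + r - 2 = r + n * (j + K * g) := by
    rw [show (g * K + j) * n = n * (j + K * g) by ring]; omega
  have h₂ : (r + n * (j + K * g)) / n = j + K * g := by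
    rw [Nat.add_mul_div_left _ _ (by omega), Nat.div_eq_of_lt hr, Nat.zero_add]
  rw [h₁, h₂]
  refine ⟨?_, ?_, ?_, ?_⟩
  · rw [Nat.add_mul_mod_self_left, Nat.mod_eq_of_lt hr]
  · rw [Nat.add_mul_div_left _ _ (by omega), Nat.div_eq_of_lt hj, Nat.zero_add]
  · rw [Nat.add_mul_mod_self_left, Nat.mod_eq_of_lt hj]
  · unfold width
    have : (g * K + j + 1) * n ≤ 2 * K * n := Nat.mul_le_mul_right _ (by nlinarith)
    rw [Nat.add_mul _ 1] at this
    omega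

theorem digit_lt {n : ℕ} (hn : 0 < n) (t j : ℕ) : digit n t j < n := Nat.mod_lt _ hn

theorem addr_left_inj {n K f t q q' : ℕ} : addr n K f t q = addr n K f t q' ↔ q = q' := by
  unfold addr; omega

theorem addr_succ_zero {n K f t : ℕ} :
    addr n K f (t + 1) 0 = addr n K f t (width n K) := by
  unfold addr; ring

theorem four_le_addr (n K f t q : ℕ) : 4 ≤ addr n K f t q := by
  unfold addr; omega

theorem gadgetTgt_lt {n K f t q b : ℕ} (A : ℕ → ℕ) (hn : 0 < n) (hK : 0 < K) (hf : f < 3)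
    (ht : t < n ^ K) (hq : q < width n K) : gadgetTgt n K A f t q b < numVerts n K := by
  have h4 : 4 ≤ numVerts n K := by unfold numVerts; omega
  have hS : 3 ≤ width n K := by unfold width; omega
  have hA := fun {q'} (h : q' < width n K) => addr_lt hf ht h
  have hrow : q < 2 ∨ width n K ≤ q + 1 ∨ q - (q - 2) % n + n < width n K := by
    by_cases h₁ : q < 2
    · exact .inl h₁
    by_cases h₂ : q + 1 < width n K
    · obtain ⟨r, hr, j, hj, g, hg, rfl⟩ := exists_row hn hK h₁ h₂
      obtain ⟨h, -, -, h'⟩ := row_decode hr hj hg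
      rw [h]
      exact .inr (.inr (by omega))
    · exact .inr (.inl (by omega))
  unfold gadgetTgt
  split_ifs <;> first
    | omega
    | exact hA (by omega)
    | exact addr_lt (by omega) (by omega) (by omega)

/-- No gadget has parallel edges: targets inside the gadget differ in their numbers, and where both
edges may lead to a dead end these are two different ones. -/
theorem gadgetTgt_ne (n K : ℕ) (A : ℕ → ℕ) (f t q : ℕ) :
    gadgetTgt n K A f t q 0 ≠ gadgetTgt n K A f t q 1 := by
  have h4 := four_le_addr n K f
  have hS : 3 ≤ width n K := by unfold width; omega
  unfold gadgetTgt
  simp only [zero_lt_one, if_true, lt_irrefl, if_false]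
  split_ifs <;>
    first
    | omega
    | (have := h4 t 1; have := h4 t 2; have := h4 (t + 1) 0; have := h4 t (q + 1)
       have := four_le_addr n K (f + 1) 0 1
       have := h4 t (q + (n - digit n t ((q - 2) / n % K)))
       have := h4 t (q - (q - 2) % n + n); omega)
    | skip
  · rw [addr_succ_zero, Ne, addr_left_inj]
    omega
  · rw [Ne, addr_left_inj]
    have := Nat.mod_le (q - 2) n
    omega

/-- The graph of the reduction, for the adjacency matrix `A` of a graph with `n` nodes. -/
def gadgetGraph {k n K : ℕ} (hk : 2 ≤ k) (hn : 0 < n) (hK : 0 < K) (A : ℕ → ℕ) : TwoOut k where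
  nv := numVerts n K
  lab := edgeLab n K
  tgt := edgeTgt n K A
  one_lt := by unfold numVerts; omega
  lab_lt i _ := (edgeLab_lt n K i).trans_le (by omega)
  tgt_lt i hi := by
    by_cases h : i / 2 < 4
    · have h4 : 4 < numVerts n K := by
        have : 0 < 3 * n ^ K * width n K := by unfold width; positivity
        unfold numVerts; omega
      unfold edgeTgt
      split_ifs <;> omega
    · obtain ⟨f, hf, t, ht, q, hq, he⟩ := exists_addr (n := n) (K := K) h (by omega)
      rw [← Nat.div_add_mod i 2, he, edgeTgt_addr A ht hq (by omega)]
      exact gadgetTgt_lt A hn hK hf ht hq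
  tgt_ne w hw := by
    by_cases h : w < 4
    · have h₁ : (2 * w) / 2 = w := by omega
      have h₂ : (2 * w + 1) / 2 = w := by omega
      have h₃ : (2 * w) % 2 = 0 := by omega
      have h₄ : (2 * w + 1) % 2 = 1 := by omega
      unfold edgeTgt
      rw [h₁, h₂, h₃, h₄, if_pos h, if_pos h]
      split_ifs <;> omega
    · obtain ⟨f, hf, t, ht, q, hq, rfl⟩ := exists_addr h hw
      rw [edgeTgt_addr A ht hq (by omega), ← Nat.add_zero (2 * _), edgeTgt_addr A ht hq (by omega)]
      exact gadgetTgt_ne n K A f t q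

/-! ### Paths through the graph of the reduction -/

section Gadget

variable {k n K : ℕ} (hk : 2 ≤ k) (hn : 0 < n) (hK : 0 < K) (A : ℕ → ℕ)

/-- The stack `st` with the code `a ^ e b` of the node `e` on top. -/
def pushNode (e : ℕ) (st : List ℕ) : List ℕ := List.replicate e 0 ++ 1 :: st

/-- The stack `st` with the codes of the first `m` entries of the tuple `t` on top. -/
def pushTuple (n t : ℕ) : ℕ → List ℕ → List ℕ
  | 0, st => st
  | m + 1, st => pushNode (digit n t m) (pushTuple n t m st)

theorem not_accepts_trap {w : ℕ} (hw : w = 2 ∨ w = 3) (st : List ℕ) :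
    ¬ (gadgetGraph hk hn hK A).Accepts w st := by
  refine TwoOut.not_accepts _ (X := {2, 3}) (by simp) ?_ hw st
  intro w hw b hb
  have hw : w = 2 ∨ w = 3 := hw
  have h₁ : (2 * w + b) / 2 = w := by omega
  have h₂ : (2 * w + b) % 2 = b := by omega
  show edgeTgt n K A _ = 2 ∨ edgeTgt n K A _ = 3
  rw [edgeTgt, h₁, h₂]
  split_ifs <;> omega

theorem accepts_addr_iff {f t q : ℕ} {st : List ℕ} :
    (gadgetGraph hk hn hK A).Accepts (addr n K f t q) st ↔
      (gadgetGraph hk hn hK A).Via (2 * addr n K f t q) st ∨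
      (gadgetGraph hk hn hK A).Via (2 * addr n K f t q + 1) st := by
  rw [TwoOut.accepts_iff, or_iff_right]
  have := four_le_addr n K f t q
  omega

theorem not_via_one {f t q : ℕ} (ht : t < n ^ K) (hq : q < width n K) {st : List ℕ}
    (h : gadgetTgt n K A f t q 1 = 3) :
    ¬ (gadgetGraph hk hn hK A).Via (2 * addr n K f t q + 1) st := by
  refine TwoOut.not_via _ (not_accepts_trap hk hn hK A (.inr ?_)) st
  exact (edgeTgt_addr A ht hq (by omega)).trans h

/-- At a vertex whose second edge leads to a dead end, only the first edge matters. -/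
theorem accepts_of_trap {f t q : ℕ} (ht : t < n ^ K) (hq : q < width n K) {st : List ℕ}
    (h : gadgetTgt n K A f t q 1 = 3) :
    (gadgetGraph hk hn hK A).Accepts (addr n K f t q) st ↔
      (gadgetGraph hk hn hK A).Via (2 * addr n K f t q) st := by
  rw [accepts_addr_iff, or_iff_left (not_via_one hk hn hK A ht hq h)]

theorem via_push_addr {f t q b c w : ℕ} (ht : t < n ^ K) (hq : q < width n K) (hb : b < 2)
    {st : List ℕ} (hl : gadgetLab n K f q b = 2 * c) (hw : gadgetTgt n K A f t q b = w) :
    (gadgetGraph hk hn hK A).Via (2 * addr n K f t q + b) st ↔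
      (gadgetGraph hk hn hK A).Accepts w (c :: st) :=
  TwoOut.via_push _ ((edgeLab_addr ht hq hb).trans hl) ((edgeTgt_addr A ht hq hb).trans hw)

theorem via_pop_addr {f t q b c w d : ℕ} (ht : t < n ^ K) (hq : q < width n K) (hb : b < 2)
    {st : List ℕ} (hl : gadgetLab n K f q b = 2 * c + 1) (hw : gadgetTgt n K A f t q b = w) :
    (gadgetGraph hk hn hK A).Via (2 * addr n K f t q + b) (d :: st) ↔
      d = c ∧ (gadgetGraph hk hn hK A).Accepts w st :=
  TwoOut.via_pop _ ((edgeLab_addr ht hq hb).trans hl) ((edgeTgt_addr A ht hq hb).trans hw)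

/-- A row of a pushing block pushes the code of one entry of the tuple. -/
theorem accepts_push_row {f t g j : ℕ} (ht : t < n ^ K) (hg : g < 2) (hfg : f ≤ g) (hj : j < K)
    (st : List ℕ) :
    (gadgetGraph hk hn hK A).Accepts (addr n K f t (2 + (g * K + j) * n)) st ↔
      (gadgetGraph hk hn hK A).Accepts (addr n K f t (2 + (g * K + (j + 1)) * n))
        (pushNode (digit n t j) st) := by
  have hnext : 2 + (g * K + (j + 1)) * n = 2 + (g * K + j) * n + n := by ring
  rw [hnext]
  -- The unary part of the code, starting `e` positions before the end of the row.
  have hrun : ∀ e < n, ∀ s : List ℕ,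
      (gadgetGraph hk hn hK A).Accepts (addr n K f t (2 + (g * K + j) * n + (n - e))) s ↔
      (gadgetGraph hk hn hK A).Accepts (addr n K f t (2 + (g * K + j) * n + n))
        (List.replicate e 0 ++ s) := by
    intro e
    induction e with
    | zero => intro _ s; rfl
    | succ e ih =>
      intro he s
      obtain ⟨h₁, h₂, h₃, h₄⟩ := row_decode (n := n) (r := n - (e + 1)) (by omega) hj hg
      have hq : 2 + (g * K + j) * n + (n - (e + 1)) < width n K := by omega
      rw [accepts_of_trap hk hn hK A ht hq, ← Nat.add_zero (2 * _),
        via_push_addr hk hn hK A ht hq (by omega) (c := 0)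
        (w := addr n K f t (2 + (g * K + j) * n + (n - e))), ih (by omega)]
      · rw [List.replicate_succ', List.append_assoc]; rfl
      · simp only [gadgetLab, h₁, h₂]
        rw [if_neg (by omega), if_neg (by omega), if_pos (by omega), if_neg (by omega),
          if_neg (by omega)]
      · simp only [gadgetTgt, h₁, h₂]
        rw [if_neg (by omega), if_neg (by omega), if_pos (by omega), if_neg (by omega),
          if_pos (by omega), if_neg (by omega)]
        congr 1; omega
      · simp only [gadgetTgt, h₁, h₂]
        rw [if_neg (by omega), if_neg (by omega), if_pos (by omega), if_neg (by omega),
          if_neg (by omega)]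
  obtain ⟨h₁, h₂, h₃, h₄⟩ := row_decode (n := n) (r := 0) hn hj hg
  have hq : 2 + (g * K + j) * n < width n K := by omega
  rw [Nat.add_zero] at h₁ h₂ h₃
  rw [accepts_of_trap hk hn hK A ht hq, ← Nat.add_zero (2 * _),
    via_push_addr hk hn hK A ht hq (by omega) (c := 1)
    (w := addr n K f t (2 + (g * K + j) * n + (n - digit n t j))), hrun _ (digit_lt hn t j)]
  · rfl
  · simp only [gadgetLab, h₁, h₂]
    rw [if_neg (by omega), if_neg (by omega), if_pos (by omega), if_neg (by omega),
      if_pos (by omega)]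
  · simp only [gadgetTgt, h₁, h₂, h₃]
    rw [if_neg (by omega), if_neg (by omega), if_pos (by omega), if_neg (by omega),
      if_pos (by omega), if_pos (by omega)]
  · simp only [gadgetTgt, h₁, h₂]
    rw [if_neg (by omega), if_neg (by omega), if_pos (by omega), if_neg (by omega),
      if_neg (by omega)]

/-- A row of a popping block pops the code of one node and checks that it is adjacent to all
entries of the tuple. -/
theorem accepts_pop_row {f t g j : ℕ} (ht : t < n ^ K) (hg : g < 2) (hfg : g < f) (hj : j < K)
    (st : List ℕ) {e : ℕ} (he : e < n) :
    (gadgetGraph hk hn hK A).Accepts (addr n K f t (2 + (g * K + j) * n)) (pushNode e st) ↔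
      0 < adjAllNum n K A t e ∧
        (gadgetGraph hk hn hK A).Accepts (addr n K f t (2 + (g * K + (j + 1)) * n)) st := by
  have hnext : 2 + (g * K + (j + 1)) * n = 2 + (g * K + j) * n + n := by ring
  rw [hnext]
  suffices ∀ e r, r + e < n →
      ((gadgetGraph hk hn hK A).Accepts (addr n K f t (2 + (g * K + j) * n + r)) (pushNode e st) ↔
      0 < adjAllNum n K A t (r + e) ∧
        (gadgetGraph hk hn hK A).Accepts (addr n K f t (2 + (g * K + j) * n + n)) st) by
    simpa using this e 0 (by omega)
  -- At place `r` of the row, `r` symbols `a` of the code have been popped. The stack decides which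
  -- of the two edges can be used: edge `0` pops an `a`, edge `1` the final `b`.
  intro e
  induction e with
  | zero =>
    intro r hr
    obtain ⟨h₁, h₂, h₃, h₄⟩ := row_decode (n := n) (r := r) (by omega) hj hg
    have hq : 2 + (g * K + j) * n + r < width n K := by omega
    have hl₀ : gadgetLab n K f (2 + (g * K + j) * n + r) 0 = 2 * 0 + 1 := by
      simp only [gadgetLab, h₁, h₂]
      rw [if_neg (by omega), if_neg (by omega), if_pos (by omega), if_pos (by omega),
        if_pos (by omega)]
    have hl₁ : gadgetLab n K f (2 + (g * K + j) * n + r) 1 = 2 * 1 + 1 := by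
      simp only [gadgetLab, h₁, h₂]
      rw [if_neg (by omega), if_neg (by omega), if_pos (by omega), if_pos (by omega),
        if_neg (by omega)]
    have ht₁ : gadgetTgt n K A f t (2 + (g * K + j) * n + r) 1 =
        if 0 < adjAllNum n K A t r then addr n K f t (2 + (g * K + j) * n + n) else 3 := by
      simp only [gadgetTgt, h₁, h₂]
      rw [if_neg (by omega), if_neg (by omega), if_pos (by omega), if_pos (by omega),
        if_neg (by omega)]
      congr 2; omega
    rw [accepts_addr_iff, ← Nat.add_zero (2 * _), pushNode, List.replicate_zero, List.nil_append,
      via_pop_addr hk hn hK A ht hq (by omega) hl₀ rfl, Nat.add_zero,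
      via_pop_addr hk hn hK A ht hq (by omega) hl₁ ht₁, or_iff_right (by simp)]
    split_ifs with h
    · simp [h]
    · simp [h, not_accepts_trap]
  | succ e ih =>
    intro r hr
    obtain ⟨h₁, h₂, h₃, h₄⟩ := row_decode (n := n) (r := r) (by omega) hj hg
    have hq : 2 + (g * K + j) * n + r < width n K := by omega
    have hl₀ : gadgetLab n K f (2 + (g * K + j) * n + r) 0 = 2 * 0 + 1 := by
      simp only [gadgetLab, h₁, h₂]
      rw [if_neg (by omega), if_neg (by omega), if_pos (by omega), if_pos (by omega),
        if_pos (by omega)]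
    have hl₁ : gadgetLab n K f (2 + (g * K + j) * n + r) 1 = 2 * 1 + 1 := by
      simp only [gadgetLab, h₁, h₂]
      rw [if_neg (by omega), if_neg (by omega), if_pos (by omega), if_pos (by omega),
        if_neg (by omega)]
    have ht₀ : gadgetTgt n K A f t (2 + (g * K + j) * n + r) 0 =
        addr n K f t (2 + (g * K + j) * n + (r + 1)) := by
      simp only [gadgetTgt, h₁, h₂]
      rw [if_neg (by omega), if_neg (by omega), if_pos (by omega), if_pos (by omega),
        if_pos (by omega), if_pos (by omega), Nat.add_assoc]
    have hst : pushNode (e + 1) st = 0 :: pushNode e st := rfl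
    rw [accepts_addr_iff, hst, ← Nat.add_zero (2 * _),
      via_pop_addr hk hn hK A ht hq (by omega) hl₀ ht₀, Nat.add_zero,
      via_pop_addr hk hn hK A ht hq (by omega) hl₁ rfl, or_iff_left (by simp), ih _ (by omega),
      Nat.add_assoc r 1 e, Nat.add_comm 1 e]
    simp

theorem accepts_push_block {f t g : ℕ} (ht : t < n ^ K) (hg : g < 2) (hfg : f ≤ g)
    (st : List ℕ) :
    (gadgetGraph hk hn hK A).Accepts (addr n K f t (2 + g * K * n)) st ↔
      (gadgetGraph hk hn hK A).Accepts (addr n K f t (2 + (g + 1) * K * n))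
        (pushTuple n t K st) := by
  suffices ∀ m ≤ K, ((gadgetGraph hk hn hK A).Accepts (addr n K f t (2 + g * K * n)) st ↔
      (gadgetGraph hk hn hK A).Accepts (addr n K f t (2 + (g * K + m) * n))
        (pushTuple n t m st)) by
    rw [this K le_rfl, Nat.add_mul g 1 K, Nat.one_mul]
  intro m
  induction m with
  | zero => intro _; rfl
  | succ m ih =>
    intro hm
    rw [ih (by omega), accepts_push_row hk hn hK A ht hg hfg (by omega)]
    rfl

theorem accepts_pop_block {f t g : ℕ} (ht : t < n ^ K) (hg : g < 2) (hfg : g < f)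
    (x : ℕ) (st : List ℕ) :
    (gadgetGraph hk hn hK A).Accepts (addr n K f t (2 + g * K * n)) (pushTuple n x K st) ↔
      (∀ i < K, 0 < adjAllNum n K A t (digit n x i)) ∧
      (gadgetGraph hk hn hK A).Accepts (addr n K f t (2 + (g + 1) * K * n)) st := by
  suffices ∀ m j, j + m = K →
      ((gadgetGraph hk hn hK A).Accepts (addr n K f t (2 + (g * K + j) * n)) (pushTuple n x m st) ↔
      (∀ i < m, 0 < adjAllNum n K A t (digit n x i)) ∧
      (gadgetGraph hk hn hK A).Accepts (addr n K f t (2 + (g * K + K) * n)) st) by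
    have := this K 0 (by omega)
    rwa [Nat.add_zero, ← Nat.succ_mul] at this
  intro m
  induction m with
  | zero => intro j hj; simp [pushTuple, show j = K by omega]
  | succ m ih =>
    intro j hj
    rw [pushTuple, accepts_pop_row hk hn hK A ht hg hfg (by omega) _ (digit_lt hn x m),
      ih _ (by omega), ← and_assoc]
    refine and_congr_left fun _ => ⟨fun h i hi => ?_, fun h => ⟨h m (by omega), fun i hi => ?_⟩⟩
    · rcases Nat.lt_succ_iff_lt_or_eq.1 hi with hi | rfl
      · exact h.2 i hi
      · exact h.1
    · exact h i (by omega)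

/-- The chain of selection vertices leads to the gadgets of all tuples that are cliques. To get from
one tuple to the next, a symbol `a` is popped and pushed again. -/
theorem accepts_select {f : ℕ} (st : List ℕ) {t : ℕ} (ht : t < n ^ K) :
    (gadgetGraph hk hn hK A).Accepts (addr n K f t 1) (0 :: st) ↔
      ∃ x, t ≤ x ∧ x < n ^ K ∧ 0 < isCliqueNum n K A x ∧
        (gadgetGraph hk hn hK A).Accepts (addr n K f x 2) st := by
  have hS : 3 ≤ width n K := by unfold width; omega
  have hstep : ∀ t < n ^ K,
      ((gadgetGraph hk hn hK A).Accepts (addr n K f t 1) (0 :: st) ↔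
        (t + 1 < n ^ K ∧ (gadgetGraph hk hn hK A).Accepts (addr n K f (t + 1) 1) (0 :: st)) ∨
        (0 < isCliqueNum n K A t ∧
          (gadgetGraph hk hn hK A).Accepts (addr n K f t 2) st)) := by
    intro t ht
    have hq : 1 < width n K := by omega
    have ht₀ : gadgetTgt n K A f t 1 0 = if t + 1 < n ^ K then addr n K f (t + 1) 0 else 2 := by
      simp [gadgetTgt]
    have ht₁ : gadgetTgt n K A f t 1 1 =
        if 0 < isCliqueNum n K A t then addr n K f t 2 else 3 := by
      simp [gadgetTgt]
    have hl : ∀ b, gadgetLab n K f 1 b = 2 * 0 + 1 := by simp [gadgetLab]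
    rw [accepts_addr_iff, ← Nat.add_zero (2 * _),
      via_pop_addr hk hn hK A ht hq (by omega) (hl 0) ht₀, Nat.add_zero,
      via_pop_addr hk hn hK A ht hq (by omega) (hl 1) ht₁]
    refine or_congr ?_ ?_
    · split_ifs with h
      · have hl₀ : gadgetLab n K f 0 0 = 2 * 0 := by simp [gadgetLab]
        have ht₀ : gadgetTgt n K A f (t + 1) 0 0 = addr n K f (t + 1) 1 := by simp [gadgetTgt]
        rw [accepts_of_trap hk hn hK A h (by omega) (by simp [gadgetTgt]), ← Nat.add_zero (2 * _),
          via_push_addr hk hn hK A h (by omega) (by omega) hl₀ ht₀]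
        simp [h]
      · simp [h, not_accepts_trap]
    · split_ifs with h
      · simp [h]
      · simp [h, not_accepts_trap]
  obtain ⟨d, hd⟩ : ∃ d, t + d + 1 = n ^ K := ⟨n ^ K - t - 1, by omega⟩
  induction d generalizing t with
  | zero =>
    rw [hstep t ht]
    constructor
    · rintro (⟨h, -⟩ | h)
      · omega
      · exact ⟨t, le_rfl, ht, h⟩
    · rintro ⟨x, hx, hx', h⟩
      obtain rfl : x = t := by omega
      exact .inr h
  | succ d ih =>
    have ht' : t + 1 < n ^ K := by omega
    have ih : _ ↔ _ := ih ht' (by omega)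
    rw [hstep t ht, ih]
    constructor
    · rintro (⟨-, x, hx, h⟩ | h)
      · exact ⟨x, by omega, h⟩
      · exact ⟨t, le_rfl, ht, h⟩
    · rintro ⟨x, hx, hx', h⟩
      by_cases hxt : x = t
      · subst hxt; exact .inr h
      · exact .inl ⟨by omega, x, by omega, hx', h⟩

/-- In the first two phases, the symbol `a` pushed at the end of a gadget is the one that the first
selection vertex of the next phase pops, so this transition leaves the stack unchanged. -/
theorem accepts_end {f t : ℕ} (ht : t < n ^ K) (hf : f < 2) (st : List ℕ) :
    (gadgetGraph hk hn hK A).Accepts (addr n K f t (2 + 2 * K * n)) st ↔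
      (gadgetGraph hk hn hK A).Accepts (addr n K (f + 1) 0 1) (0 :: st) := by
  have hq : 2 + 2 * K * n < width n K := by unfold width; omega
  have hq' : width n K = 2 + 2 * K * n + 1 := by unfold width; omega
  have hq₁ : ¬ 2 + 2 * K * n ≤ 1 := by omega
  rw [accepts_of_trap hk hn hK A ht hq, ← Nat.add_zero (2 * _),
    via_push_addr hk hn hK A ht hq (by omega) (c := 0) _ rfl]
  · simp [gadgetTgt, hq', hq₁, hf]
  · simp [gadgetLab, hq', Nat.lt_of_not_le hq₁, hf]
  · simp [gadgetTgt, hq', hq₁]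

/-- At the end of the last phase only the symbol `b` may remain that the source pushed. -/
theorem accepts_last {t : ℕ} (ht : t < n ^ K) :
    (gadgetGraph hk hn hK A).Accepts (addr n K 2 t (2 + 2 * K * n)) [1] := by
  have hq : 2 + 2 * K * n < width n K := by unfold width; omega
  have hq' : width n K = 2 + 2 * K * n + 1 := by unfold width; omega
  have hq₁ : ¬ 2 + 2 * K * n ≤ 1 := by omega
  rw [accepts_of_trap hk hn hK A ht hq, ← Nat.add_zero (2 * _),
    via_pop_addr hk hn hK A ht hq (by omega) (c := 1) (w := 1)]
  · exact ⟨rfl, .done⟩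
  · simp [gadgetLab, hq', Nat.lt_of_not_le hq₁]
  · simp [gadgetTgt, hq', hq₁]
  · simp [gadgetTgt, hq', hq₁]

/-- The target is reachable exactly if there are three cliques, given by tuples `x`, `y`, `z`, that
are completely joined to each other. -/
theorem accepts_source_iff :
    (gadgetGraph hk hn hK A).Accepts 0 [] ↔
      ∃ x < n ^ K, 0 < isCliqueNum n K A x ∧ ∃ y < n ^ K, 0 < isCliqueNum n K A y ∧
        (∀ i < K, 0 < adjAllNum n K A y (digit n x i)) ∧
        ∃ z < n ^ K, 0 < isCliqueNum n K A z ∧ (∀ i < K, 0 < adjAllNum n K A z (digit n y i)) ∧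
          ∀ i < K, 0 < adjAllNum n K A z (digit n x i) := by
  have hN : 0 < n ^ K := by positivity
  have hS : 3 ≤ width n K := by unfold width; omega
  have h₀ : (gadgetGraph hk hn hK A).Accepts 0 [] ↔
      (gadgetGraph hk hn hK A).Accepts (addr n K 0 0 1) [0, 1] := by
    have e₁ : (gadgetGraph hk hn hK A).Via 1 [] ↔ False := by
      refine iff_of_false (TwoOut.not_via _ (not_accepts_trap hk hn hK A (.inr ?_)) _) not_false
      simp [gadgetGraph, edgeTgt]
    have e₂ := TwoOut.via_push (gadgetGraph hk hn hK A) (e := 0) (c := 1)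
      (w := addr n K 0 0 0) (st := []) (by simp [gadgetGraph, edgeLab])
      (by simp [gadgetGraph, edgeTgt, addr])
    have hl₀ : gadgetLab n K 0 0 0 = 2 * 0 := by simp [gadgetLab]
    have ht₀ : gadgetTgt n K A 0 0 0 0 = addr n K 0 0 1 := by simp [gadgetTgt]
    rw [TwoOut.accepts_iff, Nat.mul_zero, Nat.zero_add, e₁, e₂, or_false,
      or_iff_right (by omega), accepts_of_trap hk hn hK A hN (by omega) (by simp [gadgetTgt]),
      ← Nat.add_zero (2 * _), via_push_addr hk hn hK A hN (by omega) (by omega) hl₀ ht₀]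
  have two : 2 = 2 + 0 * K * n := by simp
  rw [h₀, accepts_select hk hn hK A _ hN]
  simp only [Nat.zero_le, true_and]
  refine exists_congr fun x => and_congr_right fun hx => and_congr_right fun _ => ?_
  rw [two, accepts_push_block hk hn hK A hx (by omega) (by omega),
    accepts_push_block hk hn hK A hx (by omega) (by omega),
    accepts_end hk hn hK A hx (by omega), accepts_select hk hn hK A _ hN]
  simp only [Nat.zero_le, true_and]
  refine exists_congr fun y => and_congr_right fun hy => and_congr_right fun _ => ?_
  rw [two, accepts_pop_block hk hn hK A hy (by omega) (by omega),
    accepts_push_block hk hn hK A hy (by omega) (by omega),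
    accepts_end hk hn hK A hy (by omega), accepts_select hk hn hK A _ hN]
  simp only [Nat.zero_le, true_and]
  refine and_congr_right fun _ =>
    exists_congr fun z => and_congr_right fun hz => and_congr_right fun _ => ?_
  rw [two, accepts_pop_block hk hn hK A hz (by omega) (by omega),
    accepts_pop_block hk hn hK A hz (by omega) (by omega)]
  exact and_congr_right fun _ => and_iff_left (accepts_last hk hn hK A hz)

end Gadget

/-! ### Cliques and triples of tuples -/

section Clique

variable {n : ℕ} (G : SimpleGraph (Fin n))

theorem cliqueInput_arr (i j : Fin n) :
    (cliqueInput G).arr 0 (i * n + j) = 1 ∧ G.Adj i j ∨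
      (cliqueInput G).arr 0 (i * n + j) = 0 ∧ ¬ G.Adj i j := by
  have hn : 0 < n := i.pos
  have key : (∃ i' j' : Fin n, G.Adj i' j' ∧ (i : ℕ) * n + j = (i' : ℕ) * n + j') ↔ G.Adj i j := by
    constructor
    · rintro ⟨i', j', h, he⟩
      have h₁ : ∀ a b : Fin n, ((a : ℕ) * n + b) / n = a := fun a b => by
        rw [Nat.add_comm, Nat.add_mul_div_right _ _ hn, Nat.div_eq_of_lt b.2, Nat.zero_add]
      obtain rfl : i = i' := Fin.ext (by rw [← h₁ i j, he, h₁])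
      obtain rfl : j = j' := Fin.ext (by omega)
      exact h
    · exact fun h => ⟨i, j, h, rfl⟩
  by_cases h : G.Adj i j
  · exact .inl ⟨if_pos ⟨rfl, key.2 h⟩, h⟩
  · exact .inr ⟨if_neg fun h' => h (key.1 h'.2), h⟩

theorem cliqueInput_arr_pos (i j : Fin n) :
    0 < (cliqueInput G).arr 0 (i * n + j) ↔ G.Adj i j := by
  rcases cliqueInput_arr G i j with ⟨h, h'⟩ | ⟨h, h'⟩ <;> simp [h, h']

/-- The `j`-th entry of the tuple `t`, as a node. -/
def node (hn : 0 < n) (t j : ℕ) : Fin n := ⟨digit n t j, digit_lt hn t j⟩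

theorem prod_range_pos {m : ℕ} {f : ℕ → ℕ} : 0 < ∏ j ∈ Finset.range m, f j ↔ ∀ j < m, 0 < f j := by
  simp [Nat.pos_iff_ne_zero]

theorem isCliqueNum_pos (hn : 0 < n) {K t : ℕ} :
    0 < isCliqueNum n K ((cliqueInput G).arr 0) t ↔
      ∀ j < K, ∀ i < j, G.Adj (node hn t i) (node hn t j) := by
  simp only [isCliqueNum, prod_range_pos]
  exact forall₂_congr fun j _ => forall₂_congr fun i _ =>
    cliqueInput_arr_pos G (node hn t i) (node hn t j)

theorem adjAllNum_pos (hn : 0 < n) {K t : ℕ} (p : Fin n) :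
    0 < adjAllNum n K ((cliqueInput G).arr 0) t p ↔ ∀ j < K, G.Adj (node hn t j) p := by
  simp only [adjAllNum, prod_range_pos]
  exact forall₂_congr fun j _ => cliqueInput_arr_pos G (node hn t j) p

theorem exists_tuple (hn : 0 < n) (K : ℕ) (g : ℕ → Fin n) :
    ∃ x < n ^ K, ∀ j < K, node hn x j = g j := by
  refine ⟨_, (finFunctionFinEquiv fun j : Fin K => g j).2, fun j hj => ?_⟩
  have := congrFun (finFunctionFinEquiv.symm_apply_apply fun j : Fin K => g j) ⟨j, hj⟩
  exact this

theorem exists_isNClique_iff (hn : 0 < n) {m : ℕ} :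
    (∃ s : Finset (Fin n), G.IsNClique m s) ↔
      ∃ g : ℕ → Fin n, ∀ j < m, ∀ i < j, G.Adj (g i) (g j) := by
  constructor
  · rintro ⟨s, hs, hm⟩
    let e := s.equivFinOfCardEq hm
    refine ⟨fun i => if h : i < m then e.symm ⟨i, h⟩ else ⟨0, hn⟩, fun j hj i hi => ?_⟩
    have hi' : i < m := by omega
    simp only [hj, hi', dif_pos]
    refine hs (e.symm _).2 (e.symm _).2 fun h => ?_
    have := e.symm.injective (Subtype.ext h)
    simp at this
    omega
  · rintro ⟨g, hg⟩
    have hadj : ∀ i j : Fin m, i ≠ j → G.Adj (g i) (g j) := by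
      intro i j hij
      rcases lt_or_gt_of_ne (Fin.val_ne_of_ne hij) with h | h
      · exact hg j j.2 i h
      · exact (hg i i.2 j h).symm
    have hinj : Function.Injective fun i : Fin m => g i := by
      intro i j h
      by_contra hij
      exact (hadj i j hij).ne h
    refine ⟨Finset.univ.map ⟨_, hinj⟩, ?_, by simp⟩
    intro a ha b hb hab
    simp only [Finset.coe_map, Set.mem_image, Function.Embedding.coeFn_mk] at ha hb
    obtain ⟨i, -, rfl⟩ := ha
    obtain ⟨j, -, rfl⟩ := hb
    exact hadj i j fun h => hab (h ▸ rfl)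

/-- In the graph made from `G` the target is reachable exactly if `G` has a clique of `3 * K`
nodes. -/
theorem accepts_iff_exists_isNClique {k K : ℕ} (hk : 2 ≤ k) (hn : 0 < n) (hK : 0 < K) :
    (gadgetGraph hk hn hK ((cliqueInput G).arr 0)).Accepts 0 [] ↔
      ∃ s : Finset (Fin n), G.IsNClique (3 * K) s := by
  rw [accepts_source_iff, exists_isNClique_iff G hn]
  have hA : ∀ y x i, 0 < adjAllNum n K ((cliqueInput G).arr 0) y (digit n x i) ↔
      ∀ j < K, G.Adj (node hn y j) (node hn x i) :=
    fun y x i => adjAllNum_pos G hn (node hn x i)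
  simp only [isCliqueNum_pos G hn, hA]
  constructor
  · rintro ⟨x, -, hx, y, -, hy, hyx, z, -, hz, hzy, hzx⟩
    refine ⟨fun i => if i < K then node hn x i else if i < 2 * K then node hn y (i - K)
      else node hn z (i - 2 * K), fun j hj i hi => ?_⟩
    dsimp only
    split_ifs <;> first
      | omega
      | exact hx _ (by omega) _ (by omega)
      | exact hy _ (by omega) _ (by omega)
      | exact hz _ (by omega) _ (by omega)
      | exact (hyx _ (by omega) _ (by omega)).symm
      | exact (hzy _ (by omega) _ (by omega)).symm
      | exact (hzx _ (by omega) _ (by omega)).symm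
  · rintro ⟨g, hg⟩
    obtain ⟨x, hx, hgx⟩ := exists_tuple hn K g
    obtain ⟨y, hy, hgy⟩ := exists_tuple hn K fun i => g (K + i)
    obtain ⟨z, hz, hgz⟩ := exists_tuple hn K fun i => g (2 * K + i)
    refine ⟨x, hx, fun j hj i hi => ?_, y, hy, fun j hj i hi => ?_, fun i hi j hj => ?_, z, hz,
      fun j hj i hi => ?_, fun i hi j hj => ?_, fun i hi j hj => ?_⟩
    · rw [hgx j hj, hgx i (by omega)]; exact hg _ (by omega) _ hi
    · rw [hgy j hj, hgy i (by omega)]; exact hg _ (by omega) _ (by omega)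
    · rw [hgy j hj, hgx i hi]; exact (hg _ (by omega) _ (by omega)).symm
    · rw [hgz j hj, hgz i (by omega)]; exact hg _ (by omega) _ (by omega)
    · rw [hgz j hj, hgy i hi]; exact (hg _ (by omega) _ (by omega)).symm
    · rw [hgz j hj, hgx i hi]; exact (hg _ (by omega) _ (by omega)).symm

end Clique

/-! ### Executions of programs -/

theorem RamState.ext_of {s s' : RamState} (h : s.reg = s'.reg) (h' : s.arr = s'.arr) : s = s' := by
  cases s; cases s'; simp_all

theorem Exec.mono {B B' : ℕ} (hB : B ≤ B') {P : Prog} {s s' : RamState} {t : ℕ}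
    (h : Exec B P s t s') : Exec B' P s t s' := by
  induction h with
  | skip s => exact .skip s
  | op s r o x y h => exact .op s r o x y (h.trans_le hB)
  | load s r A x h => exact .load s r A x (h.trans_le hB)
  | store s A x y hx hy => exact .store s A x y (hx.trans_le hB) (hy.trans_le hB)
  | seq _ _ ih₁ ih₂ => exact .seq ih₁ ih₂
  | ifTrue h _ ih => exact .ifTrue h ih
  | ifFalse h _ ih => exact .ifFalse h ih
  | whileTrue h _ _ ih₁ ih₂ => exact .whileTrue h ih₁ ih₂
  | whileFalse h => exact .whileFalse h

theorem Exec.reg_of_notMem {B : ℕ} {P : Prog} {s s' : RamState} {t : ℕ} (h : Exec B P s t s')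
    {q : ℕ} (hq : q ∉ P.writtenRegs) : s'.reg q = s.reg q := by
  induction h with
  | skip s => rfl
  | op s r o x y h => exact Function.update_of_ne (by simpa [Prog.writtenRegs] using hq) _ _
  | load s r A x h => exact Function.update_of_ne (by simpa [Prog.writtenRegs] using hq) _ _
  | store s A x y hx hy => rfl
  | seq _ _ ih₁ ih₂ =>
    simp only [Prog.writtenRegs, List.mem_append, not_or] at hq
    rw [ih₂ hq.2, ih₁ hq.1]
  | ifTrue h _ ih =>
    simp only [Prog.writtenRegs, List.mem_append, not_or] at hq
    exact ih hq.1
  | ifFalse h _ ih =>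
    simp only [Prog.writtenRegs, List.mem_append, not_or] at hq
    exact ih hq.2
  | whileTrue h _ _ ih₁ ih₂ => rw [ih₂ hq, ih₁ hq]
  | whileFalse h => rfl

theorem Prog.loopFree_clear : ∀ l : List ℕ, (Prog.clear l).LoopFree
  | [] => trivial
  | _ :: l => ⟨trivial, loopFree_clear l⟩

theorem exec_clear {B : ℕ} (hB : 0 < B) : ∀ (l : List ℕ) (s : RamState),
    Exec B (Prog.clear l) s (l.length + 1) { s with reg := fun q => if q ∈ l then 0 else s.reg q }
  | [], s => by simpa [Prog.clear] using Exec.skip s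
  | r :: l, s => by
    have h₁ : Exec B (.op r .add (.lit 0) (.lit 0)) s 1 (s.setReg r 0) :=
      .op s r .add (.lit 0) (.lit 0) hB
    have h₂ := h₁.seq (exec_clear hB l _)
    rw [List.length_cons, Nat.add_comm]
    have e : { s with reg := fun q => if q ∈ r :: l then 0 else s.reg q } =
        { s.setReg r 0 with reg := fun q => if q ∈ l then 0 else (s.setReg r 0).reg q } := by
      refine RamState.ext_of (funext fun q => ?_) rfl
      by_cases hr : q = r <;> simp [RamState.setReg, hr]
    rw [e]
    exact h₂

/-- A single pass over a body that stores the value `f j` at place `j` of the array `F`, in the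
iteration number `j`. -/
theorem exec_forRange {B m T F : ℕ} {f : ℕ → ℕ} {body : Prog}
    (hw : ∀ q ∈ body.writtenRegs, 3 ≤ q) {s : RamState} (hs : s.reg 1 = m)
    (hreg : ∀ q, 3 ≤ q → s.reg q = 0) (hm : m < B)
    (hbody : ∀ j < m, ∀ s₁ : RamState, s₁.reg = Function.update s.reg 2 j →
      (∀ A, A ≠ F → s₁.arr A = s.arr A) →
      ∃ t ≤ T, ∃ s₂, Exec B body s₁ t s₂ ∧ s₂.arr = (s₁.setArr F j (f j)).arr) :
    ∃ t ≤ (T + body.writtenRegs.length + 3) * m + 2,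
      Exec B (Prog.forRange 2 1 body) s t
        ⟨Function.update s.reg 2 m,
          Function.update s.arr F fun a => if a < m then f a else s.arr F a⟩ := by
  -- The loop from iteration `j` on, with `d` iterations left.
  have hloop : ∀ d j, j + d = m → ∃ t ≤ (T + body.writtenRegs.length + 3) * d + 1,
      Exec B (.whileLt (.reg 2) (.reg 1) (.seq body (.seq (Prog.clear body.writtenRegs)
        (.op 2 .add (.reg 2) (.lit 1)))))
        ⟨Function.update s.reg 2 j,
          Function.update s.arr F fun a => if a < j then f a else s.arr F a⟩ t
        ⟨Function.update s.reg 2 m,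
          Function.update s.arr F fun a => if a < m then f a else s.arr F a⟩ := by
    intro d
    induction d with
    | zero =>
      rintro j rfl
      exact ⟨1, by omega, .whileFalse (by simp [Operand.val, hs])⟩
    | succ d ih =>
      intro j hj
      obtain ⟨t, ht, s₂, h₂, ha⟩ := hbody j (by omega) ⟨Function.update s.reg 2 j,
        Function.update s.arr F fun a => if a < j then f a else s.arr F a⟩ rfl
        fun A hA => Function.update_of_ne hA _ _
      obtain ⟨t', ht', h'⟩ := ih (j + 1) (by omega)
      have h₃ := exec_clear (B := B) (by omega) body.writtenRegs s₂
      have hr : (if 2 ∈ body.writtenRegs then 0 else s₂.reg 2) = j := by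
        have h2 : 2 ∉ body.writtenRegs := fun h => by have := hw 2 h; omega
        rw [if_neg h2, h₂.reg_of_notMem h2]
        simp
      have h₄ := Exec.op (B := B)
        { s₂ with reg := fun q => if q ∈ body.writtenRegs then 0 else s₂.reg q } 2 .add
        (.reg 2) (.lit 1) (by simp only [Operand.val, WordOp.eval, hr]; omega)
      refine ⟨t + (body.writtenRegs.length + 1 + 1) + t' + 1, by
        rw [Nat.mul_succ]; omega,
        .whileTrue (by simp only [Operand.val]; simp [hs]; omega) (h₂.seq (h₃.seq h₄)) ?_⟩
      convert h' using 1
      refine RamState.ext_of (funext fun q => ?_) ?_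
      · simp only [RamState.setReg, Operand.val, WordOp.eval, hr, Function.update_apply]
        split_ifs with hq hq'
        · rfl
        · exact (hreg q (hw q hq')).symm
        · rw [h₂.reg_of_notMem hq']
          simp [hq]
      · show s₂.arr = _
        rw [ha]
        simp only [RamState.setArr, Function.update_self, Function.update_idem]
        congr 1
        funext a
        rcases lt_trichotomy a j with h | rfl | h
        · simp [h, h.ne, h.trans (Nat.lt_succ_self j)]
        · simp
        · simp [h.ne', show ¬ a < j by omega, show ¬ a < j + 1 by omega]
  obtain ⟨t, ht, h⟩ := hloop m 0 (by omega)
  refine ⟨1 + t, by omega, .seq (.op s 2 .add (.lit 0) (.lit 0) (by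
    simp only [Operand.val, WordOp.eval]; omega)) ?_⟩
  convert h using 1
  refine RamState.ext_of ?_ ?_
  · rfl
  · simp [RamState.setReg]

/-! ### Compiling expressions -/

/-- Expressions in the number `n` of nodes, an index `i` and the entries of an array. Operations
have to satisfy a bound that keeps all values polynomial in `n`. -/
inductive Expr where
  | size
  | index
  | lit (c : ℕ)
  | op (o : WordOp) (ho : ∀ x y, o.eval x y ≤ x + y + x * y) (x y : Expr)
  | read (x : Expr)
  | ifLt (x y e₁ e₂ : Expr)

/-- The value of an expression. -/
def Expr.eval (n i : ℕ) (A : ℕ → ℕ) : Expr → ℕ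
  | .size => n
  | .index => i
  | .lit c => c
  | .op o _ x y => o.eval (x.eval n i A) (y.eval n i A)
  | .read x => A (x.eval n i A)
  | .ifLt x y e₁ e₂ => if x.eval n i A < y.eval n i A then e₁.eval n i A else e₂.eval n i A

/-- If the index and the array entries are less than `(n + 2) ^ c`, then all values that occur
in the computation of `e` are less than `(n + 2) ^ e.deg c`. -/
def Expr.deg (c : ℕ) : Expr → ℕ
  | .size => 1
  | .index => c
  | .lit a => a
  | .op _ _ x y => x.deg c + y.deg c
  | .read x => c + x.deg c
  | .ifLt x y e₁ e₂ => x.deg c + y.deg c + (e₁.deg c + e₂.deg c)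

/-- A bound for the time that it takes to compute an expression. -/
def Expr.cost : Expr → ℕ
  | .size => 1
  | .index => 1
  | .lit _ => 1
  | .op _ _ x y => x.cost + y.cost + 1
  | .read x => x.cost + 1
  | .ifLt x y e₁ e₂ => x.cost + y.cost + (e₁.cost + e₂.cost) + 1

/-- A program that computes an expression into the register `r`, without changing the registers
below `r`. The size is taken from register `0`, the index from register `2`, and the array is the
array number `0`. -/
def Expr.compile : Expr → ℕ → Prog
  | .size, r => .op r .add (.reg 0) (.lit 0)
  | .index, r => .op r .add (.reg 2) (.lit 0)
  | .lit c, r => .op r .add (.lit c) (.lit 0)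
  | .op o _ x y, r => .seq (x.compile r) (.seq (y.compile (r + 1))
      (.op r o (.reg r) (.reg (r + 1))))
  | .read x, r => .seq (x.compile r) (.load r 0 (.reg r))
  | .ifLt x y e₁ e₂, r => .seq (x.compile r) (.seq (y.compile (r + 1))
      (.ifLt (.reg r) (.reg (r + 1)) (e₁.compile r) (e₂.compile r)))

theorem Expr.loopFree_compile : ∀ (e : Expr) (r : ℕ), (e.compile r).LoopFree
  | .size, _ => trivial
  | .index, _ => trivial
  | .lit _, _ => trivial
  | .op _ _ x y, r => ⟨x.loopFree_compile r, y.loopFree_compile (r + 1), trivial⟩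
  | .read x, r => ⟨x.loopFree_compile r, trivial⟩
  | .ifLt x y e₁ e₂, r => ⟨x.loopFree_compile r, y.loopFree_compile (r + 1),
      e₁.loopFree_compile r, e₂.loopFree_compile r⟩

theorem Expr.le_of_mem_writtenRegs (e : Expr) (r : ℕ) : ∀ q ∈ (e.compile r).writtenRegs, r ≤ q := by
  induction e generalizing r with
  | size => simp [Expr.compile, Prog.writtenRegs]
  | index => simp [Expr.compile, Prog.writtenRegs]
  | lit c => simp [Expr.compile, Prog.writtenRegs]
  | op o ho x y ihx ihy =>
    simp only [Expr.compile, Prog.writtenRegs, List.mem_append, List.mem_singleton]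
    rintro q (h | h | rfl)
    · exact ihx r q h
    · exact (Nat.le_succ r).trans (ihy (r + 1) q h)
    · exact le_rfl
  | read x ih =>
    simp only [Expr.compile, Prog.writtenRegs, List.mem_append, List.mem_singleton]
    rintro q (h | rfl)
    · exact ih r q h
    · exact le_rfl
  | ifLt x y e₁ e₂ ihx ihy ih₁ ih₂ =>
    simp only [Expr.compile, Prog.writtenRegs, List.mem_append]
    rintro q (h | h | h | h)
    · exact ihx r q h
    · exact (Nat.le_succ r).trans (ihy (r + 1) q h)
    · exact ih₁ r q h
    · exact ih₂ r q h

theorem Expr.arrs_compile (e : Expr) (r : ℕ) :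
    (∀ A ∈ (e.compile r).loadedArrs, A = 0) ∧ (e.compile r).storedArrs = [] := by
  induction e generalizing r with
  | size => simp [Expr.compile, Prog.loadedArrs, Prog.storedArrs]
  | index => simp [Expr.compile, Prog.loadedArrs, Prog.storedArrs]
  | lit c => simp [Expr.compile, Prog.loadedArrs, Prog.storedArrs]
  | op o ho x y ihx ihy =>
    simp only [Expr.compile, Prog.loadedArrs, Prog.storedArrs, (ihx r).2, (ihy (r + 1)).2,
      List.mem_append]
    exact ⟨fun A h => h.elim ((ihx r).1 A) fun h => h.elim ((ihy _).1 A) (by simp), rfl⟩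
  | read x ih =>
    simp only [Expr.compile, Prog.loadedArrs, Prog.storedArrs, (ih r).2, List.mem_append]
    exact ⟨fun A h => h.elim ((ih r).1 A) (by simp), rfl⟩
  | ifLt x y e₁ e₂ ihx ihy ih₁ ih₂ =>
    simp only [Expr.compile, Prog.loadedArrs, Prog.storedArrs, (ihx r).2, (ihy (r + 1)).2,
      (ih₁ r).2, (ih₂ r).2, List.mem_append]
    exact ⟨fun A h => h.elim ((ihx r).1 A) fun h => h.elim ((ihy _).1 A) fun h =>
      h.elim ((ih₁ r).1 A) ((ih₂ r).1 A), rfl⟩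

theorem Expr.eval_lt {n i c : ℕ} {A : ℕ → ℕ} (hi : i < (n + 2) ^ c)
    (hA : ∀ a, A a < (n + 2) ^ c) (e : Expr) : e.eval n i A < (n + 2) ^ e.deg c := by
  have hmono : ∀ {a b : ℕ}, a ≤ b → (n + 2) ^ a ≤ (n + 2) ^ b :=
    fun h => Nat.pow_le_pow_right (by omega) h
  induction e with
  | size => simp [Expr.eval, Expr.deg]
  | index => exact hi
  | lit a =>
    exact (Nat.lt_two_pow_self).trans_le (Nat.pow_le_pow_left (by omega) a)
  | op o ho x y ihx ihy =>
    simp only [Expr.eval, Expr.deg, Nat.pow_add]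
    have h := ho (x.eval n i A) (y.eval n i A)
    have h' := Nat.mul_le_mul (Nat.succ_le_of_lt ihx) (Nat.succ_le_of_lt ihy)
    simp only [Nat.succ_eq_add_one] at h'
    nlinarith
  | read x ih => exact (hA _).trans_le (hmono (by simp [Expr.deg]))
  | ifLt x y e₁ e₂ ihx ihy ih₁ ih₂ =>
    simp only [Expr.eval]
    split_ifs
    · exact ih₁.trans_le (hmono (by simp only [Expr.deg]; omega))
    · exact ih₂.trans_le (hmono (by simp only [Expr.deg]; omega))

theorem Expr.exec_compile {n i c c' : ℕ} {A : ℕ → ℕ} (hi : i < (n + 2) ^ c)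
    (hA : ∀ a, A a < (n + 2) ^ c) (e : Expr) (hc : e.deg c ≤ c') (r : ℕ) (hr : 3 ≤ r)
    (s : RamState) (h0 : s.reg 0 = n) (h2 : s.reg 2 = i) (harr : s.arr 0 = A) :
    ∃ t ≤ e.cost, ∃ s', Exec ((n + 2) ^ c') (e.compile r) s t s' ∧ s'.arr = s.arr ∧
      s'.reg r = e.eval n i A ∧ ∀ q < r, s'.reg q = s.reg q := by
  have hlt : ∀ e : Expr, e.deg c ≤ c' → e.eval n i A < (n + 2) ^ c' := fun e he =>
    (e.eval_lt hi hA).trans_le (Nat.pow_le_pow_right (by omega) he)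
  have hset : ∀ (s : RamState) (v q : ℕ), q < r → (s.setReg r v).reg q = s.reg q :=
    fun s v q hq => Function.update_of_ne hq.ne _ _
  have hself : ∀ (s : RamState) (r v : ℕ), (s.setReg r v).reg r = v :=
    fun s r v => Function.update_self _ _ _
  induction e generalizing r s with
  | size =>
    have : n < _ := hlt .size hc
    exact ⟨1, le_rfl, _, .op s r .add (.reg 0) (.lit 0) (by simpa [Operand.val, WordOp.eval, h0]
      using this), rfl, by rw [hself]; exact h0, hset _ _⟩
  | index =>
    have : i < _ := hlt .index hc
    exact ⟨1, le_rfl, _, .op s r .add (.reg 2) (.lit 0) (by simpa [Operand.val, WordOp.eval, h2]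
      using this), rfl, by rw [hself]; exact h2, hset _ _⟩
  | lit a =>
    have : a < _ := hlt (.lit a) hc
    exact ⟨1, le_rfl, _, .op s r .add (.lit a) (.lit 0) (by simpa [Operand.val, WordOp.eval]
      using this), rfl, by rw [hself]; rfl, hset _ _⟩
  | op o ho x y ihx ihy =>
    have hlt' := hlt _ hc
    simp only [Expr.deg] at hc
    obtain ⟨t₁, ht₁, s₁, h₁, ha₁, hv₁, hq₁⟩ := ihx (by omega) r hr s h0 h2 harr hset
    obtain ⟨t₂, ht₂, s₂, h₂, ha₂, hv₂, hq₂⟩ := ihy (by omega) (r + 1) (by omega) s₁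
      (by rw [hq₁ 0 (by omega), h0]) (by rw [hq₁ 2 (by omega), h2]) (by rw [ha₁, harr])
      (fun s v q hq => Function.update_of_ne hq.ne _ _)
    have e₁ : (Operand.reg r).val s₂ = x.eval n i A := (hq₂ r (by omega)).trans hv₁
    have e₂ : (Operand.reg (r + 1)).val s₂ = y.eval n i A := hv₂
    have h₃ := Exec.op (B := (n + 2) ^ c') s₂ r o (.reg r) (.reg (r + 1)) (by
      rw [e₁, e₂]; exact hlt')
    refine ⟨t₁ + (t₂ + 1), by simp only [Expr.cost]; omega, _, h₁.seq (h₂.seq h₃), ?_, ?_, ?_⟩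
    · exact ha₂.trans ha₁
    · rw [hself, e₁, e₂]; rfl
    · intro q hq
      rw [hset _ _ q hq, hq₂ q (by omega), hq₁ q hq]
  | read x ih =>
    have hlt' := hlt _ hc
    simp only [Expr.deg] at hc
    obtain ⟨t₁, ht₁, s₁, h₁, ha₁, hv₁, hq₁⟩ := ih (by omega) r hr s h0 h2 harr hset
    have e₁ : s₁.arr 0 ((Operand.reg r).val s₁) = A (x.eval n i A) := by
      rw [ha₁, harr]; exact congrArg A hv₁
    have h₂ := Exec.load (B := (n + 2) ^ c') s₁ r 0 (.reg r) (by rw [e₁]; exact hlt')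
    refine ⟨t₁ + 1, by simp only [Expr.cost]; omega, _, h₁.seq h₂, ha₁, ?_, ?_⟩
    · rw [hself, e₁]; rfl
    · intro q hq
      rw [hset _ _ q hq, hq₁ q hq]
  | ifLt x y e₁ e₂ ihx ihy ih₁ ih₂ =>
    simp only [Expr.deg] at hc
    obtain ⟨t₁, ht₁, s₁, h₁, ha₁, hv₁, hq₁⟩ := ihx (by omega) r hr s h0 h2 harr hset
    obtain ⟨t₂, ht₂, s₂, h₂, ha₂, hv₂, hq₂⟩ := ihy (by omega) (r + 1) (by omega) s₁
      (by rw [hq₁ 0 (by omega), h0]) (by rw [hq₁ 2 (by omega), h2]) (by rw [ha₁, harr])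
      (fun s v q hq => Function.update_of_ne hq.ne _ _)
    have e₁' : (Operand.reg r).val s₂ = x.eval n i A := (hq₂ r (by omega)).trans hv₁
    have e₂' : (Operand.reg (r + 1)).val s₂ = y.eval n i A := hv₂
    have hq : ∀ q < r, s₂.reg q = s.reg q := fun q hq => by rw [hq₂ q (by omega), hq₁ q hq]
    have hs₂ : s₂.reg 0 = n ∧ s₂.reg 2 = i ∧ s₂.arr 0 = A :=
      ⟨by rw [hq 0 (by omega), h0], by rw [hq 2 (by omega), h2], by rw [ha₂, ha₁, harr]⟩
    by_cases h : x.eval n i A < y.eval n i A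
    · obtain ⟨t₃, ht₃, s₃, h₃, ha₃, hv₃, hq₃⟩ := ih₁ (by omega) r hr s₂ hs₂.1 hs₂.2.1 hs₂.2.2 hset
      refine ⟨t₁ + (t₂ + (t₃ + 1)), by simp only [Expr.cost]; omega, s₃,
        h₁.seq (h₂.seq (.ifTrue (by rwa [e₁', e₂']) h₃)), by rw [ha₃, ha₂, ha₁], ?_,
        fun q hq' => by rw [hq₃ q hq', hq q hq']⟩
      rw [hv₃, Expr.eval, if_pos h]
    · obtain ⟨t₃, ht₃, s₃, h₃, ha₃, hv₃, hq₃⟩ := ih₂ (by omega) r hr s₂ hs₂.1 hs₂.2.1 hs₂.2.2 hset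
      refine ⟨t₁ + (t₂ + (t₃ + 1)), by simp only [Expr.cost]; omega, s₃,
        h₁.seq (h₂.seq (.ifFalse (by rwa [e₁', e₂']) h₃)), by rw [ha₃, ha₂, ha₁], ?_,
        fun q hq' => by rw [hq₃ q hq', hq q hq']⟩
      rw [hv₃, Expr.eval, if_neg h]

/-! ### Expressible functions -/

/-- The function `f` of the number of nodes, an index and an array is the value of an expression. -/
def Expressible (f : ℕ → ℕ → (ℕ → ℕ) → ℕ) : Prop :=
  ∃ e : Expr, ∀ n i A, e.eval n i A = f n i A

namespace Expressible

variable {f g a b : ℕ → ℕ → (ℕ → ℕ) → ℕ}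

theorem size : Expressible fun n _ _ => n := ⟨.size, fun _ _ _ => rfl⟩

theorem index : Expressible fun _ i _ => i := ⟨.index, fun _ _ _ => rfl⟩

theorem const (c : ℕ) : Expressible fun _ _ _ => c := ⟨.lit c, fun _ _ _ => rfl⟩

theorem op (o : WordOp) (ho : ∀ x y, o.eval x y ≤ x + y + x * y) :
    Expressible f → Expressible g → Expressible fun n i A => o.eval (f n i A) (g n i A)
  | ⟨x, hx⟩, ⟨y, hy⟩ => ⟨.op o ho x y, fun n i A => by rw [Expr.eval, hx, hy]⟩

theorem add (hf : Expressible f) (hg : Expressible g) :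
    Expressible fun n i A => f n i A + g n i A :=
  op .add (fun x y => by simp [WordOp.eval]) hf hg

theorem sub (hf : Expressible f) (hg : Expressible g) :
    Expressible fun n i A => f n i A - g n i A :=
  op .sub (fun x y => by simp only [WordOp.eval]; omega) hf hg

theorem mul (hf : Expressible f) (hg : Expressible g) :
    Expressible fun n i A => f n i A * g n i A :=
  op .mul (fun x y => by simp [WordOp.eval]) hf hg

theorem div (hf : Expressible f) (hg : Expressible g) :
    Expressible fun n i A => f n i A / g n i A :=
  op .div (fun x y => by have := Nat.div_le_self x y; simp only [WordOp.eval]; omega) hf hg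

theorem mod (hf : Expressible f) (hg : Expressible g) :
    Expressible fun n i A => f n i A % g n i A :=
  op .mod (fun x y => by have := Nat.mod_le x y; simp only [WordOp.eval]; omega) hf hg

theorem read : Expressible f → Expressible fun n i A => A (f n i A)
  | ⟨x, hx⟩ => ⟨.read x, fun n i A => by rw [Expr.eval, hx]⟩

theorem ite : Expressible a → Expressible b → Expressible f → Expressible g →
    Expressible fun n i A => if a n i A < b n i A then f n i A else g n i A
  | ⟨x, hx⟩, ⟨y, hy⟩, ⟨e₁, h₁⟩, ⟨e₂, h₂⟩ =>
    ⟨.ifLt x y e₁ e₂, fun n i A => by rw [Expr.eval, hx, hy, h₁, h₂]⟩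

theorem prod {f : ℕ → ℕ → ℕ → (ℕ → ℕ) → ℕ} (hf : ∀ j, Expressible (f j)) :
    ∀ m, Expressible fun n i A => ∏ j ∈ Finset.range m, f j n i A
  | 0 => const 1
  | m + 1 => by
    simp only [Finset.prod_range_succ]
    exact (prod hf m).mul (hf m)

theorem pow (m : ℕ) : Expressible fun n _ _ => n ^ m := by
  simpa using prod (fun _ => size) m

theorem digit (hf : Expressible f) (j : ℕ) : Expressible fun n i A => digit n (f n i A) j :=
  (hf.div (pow j)).mod size

/-- The entry of a tuple at a computed place, found by comparison with all possible places. -/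
theorem digit_of_lt {K : ℕ} (hf : Expressible f) (hg : Expressible g)
    (hK : ∀ n i A, g n i A < K) : Expressible fun n i A => _root_.digit n (f n i A) (g n i A) := by
  suffices ∀ m, ∃ h, Expressible h ∧
      ∀ n i A, g n i A < m → h n i A = _root_.digit n (f n i A) (g n i A) by
    obtain ⟨h, ⟨e, he⟩, hh⟩ := this K
    exact ⟨e, fun n i A => by rw [he, hh n i A (hK n i A)]⟩
  intro m
  induction m with
  | zero => exact ⟨_, const 0, fun n i A h => absurd h (Nat.not_lt_zero _)⟩
  | succ m ih =>
    obtain ⟨h, he, hh⟩ := ih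
    refine ⟨_, hg.ite (const m) he (hf.digit m), fun n i A hlt => ?_⟩
    split_ifs with hm
    · exact hh n i A hm
    · rw [show g n i A = m by omega]

theorem isCliqueNum (K : ℕ) (hf : Expressible f) :
    Expressible fun n i A => isCliqueNum n K A (f n i A) :=
  prod (fun j => prod (fun i => (((hf.digit i).mul size).add (hf.digit j)).read) j) K

theorem adjAllNum (K : ℕ) (hf : Expressible f) (hg : Expressible g) :
    Expressible fun n i A => adjAllNum n K A (f n i A) (g n i A) :=
  prod (fun j => (((hf.digit j).mul size).add hg).read) K

theorem width (K : ℕ) : Expressible fun n _ _ => width n K :=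
  ((const (2 * K)).mul size).add (const 3)

theorem addr (K : ℕ) (hf : Expressible f) (hg : Expressible g) (ha : Expressible a) :
    Expressible fun n i A => addr n K (f n i A) (g n i A) (a n i A) :=
  ((const 4).add (((hf.mul (pow K)).add hg).mul (width K))).add ha

theorem gadgetLab (K : ℕ) (hf : Expressible f) (ha : Expressible a) (hb : Expressible b) :
    Expressible fun n i A => gadgetLab n K (f n i A) (a n i A) (b n i A) := by
  have hq := ha.sub (const 2)
  exact ha.ite (const 1) (const 0) <| ha.ite (const 2) (const 1) <|
    (ha.add (const 1)).ite (width K)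
      (((hq.div size).div (const K)).ite hf (hb.ite (const 1) (const 1) (const 3))
        ((hq.mod size).ite (const 1) (const 2) (const 0)))
      (hf.ite (const 2) (const 0) (const 3))

theorem gadgetTgt {K : ℕ} (hK : 0 < K) (hf : Expressible f) (hg : Expressible g)
    (ha : Expressible a) (hb : Expressible b) :
    Expressible fun n i A => gadgetTgt n K A (f n i A) (g n i A) (a n i A) (b n i A) := by
  have hq := ha.sub (const 2)
  have hp := hq.mod size
  have hd := hg.digit_of_lt ((hq.div size).mod (const K)) fun n i A => Nat.mod_lt _ hK
  exact ha.ite (const 1) (hb.ite (const 1) (addr K hf hg (const 1)) (const 3)) <|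
    ha.ite (const 2)
      (hb.ite (const 1)
        ((hg.add (const 1)).ite (pow K) (addr K hf (hg.add (const 1)) (const 0)) (const 2))
        ((const 0).ite (isCliqueNum K hg) (addr K hf hg (const 2)) (const 3))) <|
    (ha.add (const 1)).ite (width K)
      (((hq.div size).div (const K)).ite hf
        (hb.ite (const 1)
          ((hp.add (const 1)).ite size (addr K hf hg (ha.add (const 1))) (const 2))
          ((const 0).ite (adjAllNum K hg hp) (addr K hf hg ((ha.sub hp).add size)) (const 3)))
        (hb.ite (const 1)
          (addr K hf hg (hp.ite (const 1) (ha.add (size.sub hd)) (ha.add (const 1))))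
          (const 3)))
      (hb.ite (const 1)
        (hf.ite (const 2) (addr K (hf.add (const 1)) (const 0) (const 1)) (const 1)) (const 3))

theorem edgeLab (K : ℕ) : Expressible fun n i _ => edgeLab n K i := by
  have hw := index.div (const 2)
  have hv := hw.sub (const 4)
  exact hw.ite (const 4) (hw.ite (const 1) (const 2) (const 0))
    (gadgetLab K ((hv.div (width K)).div (pow K)) (hv.mod (width K)) (index.mod (const 2)))

theorem edgeTgt {K : ℕ} (hK : 0 < K) : Expressible fun n i A => edgeTgt n K A i := by
  have hw := index.div (const 2)
  have hv := hw.sub (const 4)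
  exact hw.ite (const 4)
    ((index.mod (const 2)).ite (const 1) (hw.ite (const 1) (const 4) (const 2)) (const 3))
    (gadgetTgt hK ((hv.div (width K)).div (pow K)) ((hv.div (width K)).mod (pow K))
      (hv.mod (width K)) (index.mod (const 2)))

theorem numVerts (K : ℕ) : Expressible fun n _ _ => numVerts n K :=
  (const 4).add (((const 3).mul (pow K)).mul (width K))

end Expressible

/-! ### The preprocessing programs -/

/-- Compute an expression into register `1`. -/
def Prog.assignCount (e : Expr) : Prog :=
  .seq (e.compile 3) (.seq (.op 1 .add (.reg 3) (.lit 0)) (.clear (e.compile 3).writtenRegs))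

theorem Prog.elementary_assignCount (e : Expr) : Elementary (Prog.assignCount e) :=
  .loopFree ⟨e.loopFree_compile 3, trivial, Prog.loopFree_clear _⟩

theorem exec_assignCount {n c c' : ℕ} (e : Expr) {s : RamState} (h0 : s.reg 0 = n)
    (hreg : ∀ q, 2 ≤ q → s.reg q = 0) (hA : ∀ a, s.arr 0 a < (n + 2) ^ c) (hc : e.deg c ≤ c') :
    ∃ t ≤ e.cost + (e.compile 3).writtenRegs.length + 2,
      Exec ((n + 2) ^ c') (Prog.assignCount e) s t (s.setReg 1 (e.eval n 0 (s.arr 0))) := by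
  have hpos : 0 < (n + 2) ^ c := by positivity
  obtain ⟨t, ht, s₁, h₁, ha, hv, hq⟩ := e.exec_compile hpos hA hc 3 le_rfl s h0 (hreg 2 le_rfl) rfl
  have hv' : (Operand.reg 3).val s₁ = e.eval n 0 (s.arr 0) := hv
  have hlt := (e.eval_lt hpos hA).trans_le (Nat.pow_le_pow_right (by omega : 0 < n + 2) hc)
  have h₂ := Exec.op (B := (n + 2) ^ c') s₁ 1 .add (.reg 3) (.lit 0) (by
    rw [hv']; exact hlt)
  have h₃ := h₁.seq (h₂.seq (exec_clear (by positivity) (e.compile 3).writtenRegs _))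
  refine ⟨t + (1 + ((e.compile 3).writtenRegs.length + 1)), by omega, ?_⟩
  have h₄ : Exec ((n + 2) ^ c') (Prog.assignCount e) s _ _ := h₃
  convert h₄ using 1
  refine RamState.ext_of (funext fun q => ?_) ha.symm
  have hmem := e.le_of_mem_writtenRegs 3
  rw [hv']
  simp only [RamState.setReg, Function.update_apply]
  split_ifs with hq₁ hq₂ hq₂
  · have := hmem q hq₂; omega
  · rfl
  · exact hreg q (by have := hmem q hq₂; omega)
  · exact (h₁.reg_of_notMem hq₂).symm

/-- Fill the array `F` with the values of an expression. -/
def Prog.fill (F : ℕ) (e : Expr) : Prog :=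
  .forRange 2 1 (.seq (e.compile 3) (.store F (.reg 2) (.reg 3)))

theorem Prog.elementary_fill {F : ℕ} (hF : F ≠ 0) (e : Expr) : Elementary (Prog.fill F e) := by
  have hmem := e.le_of_mem_writtenRegs 3
  refine .pass ⟨e.loopFree_compile 3, trivial⟩ (by omega) (fun h => ?_) (fun h => ?_)
    fun A hA hA' => ?_
  · have := hmem 2 (by simpa [Prog.writtenRegs] using h)
    omega
  · have := hmem 1 (by simpa [Prog.writtenRegs] using h)
    omega
  · have h₁ := (e.arrs_compile 3).1 A (by simpa [Prog.loadedArrs] using hA)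
    simp only [Prog.storedArrs, (e.arrs_compile 3).2, List.nil_append, List.mem_singleton] at hA'
    omega

theorem exec_fill {n m c c' F : ℕ} (hF : F ≠ 0) (e : Expr) {A ρ : ℕ → ℕ} {α : ℕ → ℕ → ℕ}
    (x : ℕ) (h0 : ρ 0 = n) (h1 : ρ 1 = m) (hreg : ∀ q, 3 ≤ q → ρ q = 0) (hα : α 0 = A)
    (hA : ∀ a, A a < (n + 2) ^ c) (hm : m < (n + 2) ^ c) (hc : e.deg c ≤ c') (hcc : c ≤ c') :
    ∃ t ≤ (e.cost + 1 + (e.compile 3).writtenRegs.length + 3) * m + 2,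
      Exec ((n + 2) ^ c') (Prog.fill F e) ⟨Function.update ρ 2 x, α⟩ t
        ⟨Function.update ρ 2 m,
          Function.update α F fun a => if a < m then e.eval n a A else α F a⟩ := by
  have hpow : (n + 2) ^ c ≤ (n + 2) ^ c' := Nat.pow_le_pow_right (by omega) hcc
  have hw : (Prog.seq (e.compile 3) (.store F (.reg 2) (.reg 3))).writtenRegs =
      (e.compile 3).writtenRegs := by simp [Prog.writtenRegs]
  have := exec_forRange (B := (n + 2) ^ c') (m := m) (T := e.cost + 1) (F := F)
    (f := fun j => e.eval n j A) (s := ⟨Function.update ρ 2 x, α⟩)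
    (body := .seq (e.compile 3) (.store F (.reg 2) (.reg 3)))
    (by rw [hw]; exact e.le_of_mem_writtenRegs 3) (by simpa using h1)
    (fun q hq => by simp [show q ≠ 2 by omega, hreg q hq]) (by omega) (by
      intro j hj s₁ hs₁ ha₁
      obtain ⟨t, ht, s₂, h₂, ha₂, hv₂, hq₂⟩ := e.exec_compile (i := j) (by omega) hA hc 3 le_rfl s₁
        (by rw [hs₁]; simpa using h0) (by rw [hs₁]; simp) ((ha₁ 0 hF.symm).trans hα)
      have e₁ : (Operand.reg 2).val s₂ = j := by
        have := hq₂ 2 (by omega)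
        rw [hs₁] at this
        simpa [Operand.val] using this
      have e₂ : (Operand.reg 3).val s₂ = e.eval n j A := hv₂
      have hlt := (e.eval_lt (by omega : j < (n + 2) ^ c) hA).trans_le
        (Nat.pow_le_pow_right (by omega : 0 < n + 2) hc)
      have h₃ := Exec.store (B := (n + 2) ^ c') s₂ F (.reg 2) (.reg 3) (by rw [e₁]; omega)
        (by rw [e₂]; exact hlt)
      refine ⟨t + 1, by omega, _, h₂.seq h₃, ?_⟩
      rw [e₁, e₂]
      simp only [RamState.setArr, ha₂])
  rwa [hw, Function.update_idem] at this

/-- Overwrite the array `0` by zeros. -/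
def Prog.eraseInput : Prog := .forRange 2 1 (.store 0 (.reg 2) (.lit 0))

theorem Prog.elementary_eraseInput : Elementary Prog.eraseInput :=
  .pass trivial (by omega) (by simp [Prog.writtenRegs]) (by simp [Prog.writtenRegs])
    (by simp [Prog.loadedArrs])

theorem exec_eraseInput {B m : ℕ} {ρ : ℕ → ℕ} {α : ℕ → ℕ → ℕ} (x : ℕ) (h1 : ρ 1 = m)
    (hreg : ∀ q, 3 ≤ q → ρ q = 0) (hm : m < B) :
    ∃ t ≤ 4 * m + 2, Exec B Prog.eraseInput ⟨Function.update ρ 2 x, α⟩ t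
      ⟨Function.update ρ 2 m, Function.update α 0 fun a => if a < m then 0 else α 0 a⟩ := by
  have := exec_forRange (T := 1) (F := 0) (f := fun _ => 0) (s := ⟨Function.update ρ 2 x, α⟩)
    (body := .store 0 (.reg 2) (.lit 0)) (by simp [Prog.writtenRegs]) (by simpa using h1)
    (fun q hq => by simp [show q ≠ 2 by omega, hreg q hq]) hm (by
      intro j hj s₁ hs₁ _
      have e₁ : (Operand.reg 2).val s₁ = j := by simp [Operand.val, hs₁]
      refine ⟨1, le_rfl, _, .store s₁ 0 (.reg 2) (.lit 0) (by omega)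
        (by simp only [Operand.val]; omega), ?_⟩
      rw [e₁]; rfl)
  rwa [Function.update_idem] at this

/-- Put the number of vertices, which is half the number of edges, and the two vertices `0` and `y`
into the registers. -/
def Prog.setQuery (y : ℕ) : Prog :=
  .seq (.op 0 .div (.reg 1) (.lit 2))
    (.seq (.op 2 .add (.lit 0) (.lit 0)) (.op 3 .add (.lit y) (.lit 0)))

theorem exec_setQuery {B y : ℕ} (hy : y < B) {s : RamState} (hB : s.reg 1 < B) :
    Exec B (Prog.setQuery y) s 3 (((s.setReg 0 (s.reg 1 / 2)).setReg 2 0).setReg 3 y) :=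
  .seq (.op s 0 .div (.reg 1) (.lit 2) ((Nat.div_le_self _ _).trans_lt hB))
    (.seq (.op _ 2 .add (.lit 0) (.lit 0) ((Nat.zero_le y).trans_lt hy))
      (.op _ 3 .add (.lit y) (.lit 0) hy))

/-- Build the graph with the edges given by expressions for their number, their sources, labels and
targets, and run `P` on it. -/
def Prog.onGraph (eM eS eL eT : Expr) (y : ℕ) (P : Prog) : Prog :=
  .seq (.assignCount eM) <| .seq (.fill 1 eS) <| .seq (.fill 2 eL) <| .seq (.fill 3 eT) <|
    .seq .eraseInput <| .seq (.setQuery y) P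

theorem Combinatorial.onGraph {base : Set Prog} {P : Prog} (hP : Combinatorial base P)
    (eM eS eL eT : Expr) (y : ℕ) : Combinatorial base (P.onGraph eM eS eL eT y) :=
  .pre (Prog.elementary_assignCount eM) <| .pre (Prog.elementary_fill (by omega) eS) <|
    .pre (Prog.elementary_fill (by omega) eL) <| .pre (Prog.elementary_fill (by omega) eT) <|
    .pre Prog.elementary_eraseInput <| .pre (.loopFree ⟨trivial, trivial, trivial⟩) hP

theorem TwoOut.graphInput_arr {k : ℕ} (D : TwoOut k) (x y F i : ℕ) :
    (graphInput D.graph x y).arr F i = if i < 2 * D.nv then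
      if F = 1 then i / 2 else if F = 2 then D.lab i else if F = 3 then D.tgt i else 0
      else 0 := by
  by_cases h : i < 2 * D.nv
  · have : D.graph.edges[i]? = some (⟨i / 2, by show _ < D.nv; omega⟩,
        Paren.decode (D.lab i) (D.lab_lt i h), ⟨D.tgt i, D.tgt_lt i h⟩) := by
      exact (List.getElem?_ofFn (f := fun i : Fin (2 * D.nv) => _)).trans (dif_pos h)
    simp [graphInput, this, h, Paren.code_decode]
  · have : D.graph.edges[i]? = none := by
      exact (List.getElem?_ofFn (f := fun i : Fin (2 * D.nv) => _)).trans (dif_neg h)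
    simp [graphInput, this, h]

/-- The time that the preprocessing takes, per edge. -/
def Expr.passCost (e : Expr) : ℕ := e.cost + (e.compile 3).writtenRegs.length + 6

/-- The preprocessing takes linear time and leaves exactly the memory that presents the graph. -/
theorem exec_onGraph {k n c c' y t : ℕ} {D : TwoOut k} {eM eS eL eT : Expr} {P : Prog}
    {s s' : RamState} (h0 : s.reg 0 = n) (hreg : ∀ q, 1 ≤ q → s.reg q = 0)
    (harr : ∀ F a, F ≠ 0 ∨ 2 * D.nv ≤ a → s.arr F a = 0) (hA : ∀ a, s.arr 0 a < (n + 2) ^ c)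
    (hM : eM.eval n 0 (s.arr 0) = 2 * D.nv)
    (hS : ∀ i < 2 * D.nv, eS.eval n i (s.arr 0) = i / 2)
    (hL : ∀ i < 2 * D.nv, eL.eval n i (s.arr 0) = D.lab i)
    (hT : ∀ i < 2 * D.nv, eT.eval n i (s.arr 0) = D.tgt i)
    (hm : 2 * D.nv < (n + 2) ^ c) (hcM : eM.deg c ≤ c') (hcS : eS.deg c ≤ c')
    (hcL : eL.deg c ≤ c') (hcT : eT.deg c ≤ c') (hcc : c ≤ c') (hy : y ≤ 1)
    (hP : Exec ((n + 2) ^ c') P (graphInput D.graph 0 y) t s') :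
    ∃ t' ≤ (eM.passCost + eS.passCost + eL.passCost + eT.passCost + 9) * D.graph.m + t,
      Exec ((n + 2) ^ c') (P.onGraph eM eS eL eT y) s t' s' := by
  have hpow : (n + 2) ^ c ≤ (n + 2) ^ c' := Nat.pow_le_pow_right (by omega) hcc
  have hD := D.one_lt
  obtain ⟨t₁, ht₁, h₁⟩ := exec_assignCount eM h0 (fun q hq => hreg q (by omega)) hA hcM
  rw [hM] at h₁
  have hρ : ∀ q, 3 ≤ q → (s.setReg 1 (2 * D.nv)).reg q = 0 := fun q hq => by
    simp [RamState.setReg, show q ≠ 1 by omega, hreg q (by omega)]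
  have hρ0 : (s.setReg 1 (2 * D.nv)).reg 0 = n := by simpa [RamState.setReg] using h0
  have hρ1 : (s.setReg 1 (2 * D.nv)).reg 1 = 2 * D.nv := by simp [RamState.setReg]
  have hρ2 : (s.setReg 1 (2 * D.nv)).reg 2 = 0 := by simp [RamState.setReg, hreg 2 (by omega)]
  have hs₁ : s.setReg 1 (2 * D.nv) =
      ⟨Function.update (s.setReg 1 (2 * D.nv)).reg 2 0, s.arr⟩ := by
    refine RamState.ext_of ?_ rfl
    rw [← hρ2, Function.update_eq_self]
  rw [hs₁] at h₁
  generalize (s.setReg 1 (2 * D.nv)).reg = ρ at *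
  obtain ⟨t₂, ht₂, h₂⟩ := exec_fill (F := 1) (by omega) eS 0 hρ0 hρ1 hρ (α := s.arr) rfl hA hm
    hcS hcc
  obtain ⟨t₃, ht₃, h₃⟩ := exec_fill (F := 2) (by omega) eL (2 * D.nv) hρ0 hρ1 hρ
    (α := Function.update s.arr 1 _) (A := s.arr 0) (by simp) hA hm hcL hcc
  obtain ⟨t₄, ht₄, h₄⟩ := exec_fill (F := 3) (by omega) eT (2 * D.nv) hρ0 hρ1 hρ
    (α := Function.update (Function.update s.arr 1 _) 2 _) (A := s.arr 0) (by simp) hA hm hcT hcc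
  obtain ⟨t₅, ht₅, h₅⟩ := exec_eraseInput (B := (n + 2) ^ c') (2 * D.nv) hρ1 hρ (by omega)
    (α := Function.update (Function.update (Function.update s.arr 1 _) 2 _) 3 _)
  have hall := h₁.seq (h₂.seq (h₃.seq (h₄.seq (h₅.seq ((exec_setQuery (y := y) (by omega) (by
    simp [hρ1]; omega)).seq (Q := P) (s₂ := s') (t₂ := t) (by
    convert hP using 1
    refine RamState.ext_of (funext fun q => ?_) (funext fun F => funext fun i => ?_)
    · have hn : D.graph.n = D.nv := rfl
      have hq : q = 0 ∨ q = 1 ∨ q = 2 ∨ q = 3 ∨ 4 ≤ q := by omega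
      rcases hq with rfl | rfl | rfl | rfl | hq
      · simp [RamState.setReg, graphInput, hρ1, hn]
      · simp [RamState.setReg, graphInput, hρ1, D.graph_m]
      · simp [RamState.setReg, graphInput]
      · simp [RamState.setReg, graphInput]
      · simp [RamState.setReg, graphInput, hρ q (by omega), show q ≠ 0 by omega,
          show q ≠ 1 by omega, show q ≠ 2 by omega, show q ≠ 3 by omega]
    · rw [D.graphInput_arr]
      have hF : F = 0 ∨ F = 1 ∨ F = 2 ∨ F = 3 ∨ 4 ≤ F := by omega
      by_cases hi : i < 2 * D.nv
      · rcases hF with rfl | rfl | rfl | rfl | hF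
        · simp [RamState.setReg, hi]
        · simp [RamState.setReg, hi, hS]
        · simp [RamState.setReg, hi, hL]
        · simp [RamState.setReg, hi, hT]
        · simp [RamState.setReg, hi, show F ≠ 0 by omega,
            show F ≠ 1 by omega, show F ≠ 2 by omega, show F ≠ 3 by omega, harr]
      · have : ∀ F, s.arr F i = 0 := fun F => harr F i (.inr (by omega))
        rcases hF with rfl | rfl | rfl | rfl | hF
        · simp [RamState.setReg, hi, this]
        · simp [RamState.setReg, hi, this]
        · simp [RamState.setReg, hi, this]
        · simp [RamState.setReg, hi, this]
        · simp [RamState.setReg, hi, show F ≠ 0 by omega,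
            show F ≠ 1 by omega, show F ≠ 2 by omega, show F ≠ 3 by omega, this]))))))
  refine ⟨_, ?_, hall⟩
  rw [D.graph_m]
  have := Nat.le_mul_of_pos_right (eM.cost + (eM.compile 3).writtenRegs.length)
    (by omega : 0 < 2 * D.nv)
  simp only [Expr.passCost, Nat.add_mul] at *
  omega

/-! ### The lower bound -/

theorem two_mul_numVerts_le {n : ℕ} (hn : 0 < n) (K : ℕ) :
    2 * numVerts n K ≤ (12 * K + 26) * n ^ (K + 1) := by
  have h₁ : n ^ K ≤ n ^ (K + 1) := Nat.pow_le_pow_right hn (Nat.le_succ K)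
  have h₂ : 1 ≤ n ^ (K + 1) := Nat.one_le_pow _ _ hn
  unfold numVerts width
  calc 2 * (4 + 3 * n ^ K * (2 * K * n + 3)) = 8 + 12 * K * n ^ (K + 1) + 18 * n ^ K := by ring
    _ ≤ 8 * n ^ (K + 1) + 12 * K * n ^ (K + 1) + 18 * n ^ (K + 1) := by omega
    _ = (12 * K + 26) * n ^ (K + 1) := by ring

/-- The adjacency matrix is no longer than the list of edges, so that a pass over the edges erases
all of it. -/
theorem sq_le_two_mul_numVerts {n K : ℕ} (hK : 0 < K) : n * n ≤ 2 * numVerts n K := by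
  have h₁ : n ≤ n ^ K := Nat.le_self_pow hK.ne' n
  have h₂ : n ≤ width n K := by
    have : n ≤ 2 * K * n := Nat.le_mul_of_pos_left n (by omega)
    unfold width; omega
  have h₃ := Nat.mul_le_mul h₁ h₂
  have h₄ : 3 * n ^ K * width n K = 3 * (n ^ K * width n K) := by ring
  unfold numVerts
  omega

theorem cliqueInput_arr_lt {n : ℕ} (G : SimpleGraph (Fin n)) (a : ℕ) :
    (cliqueInput G).arr 0 a < n + 2 := by
  simp only [cliqueInput]
  split_ifs <;> omega

theorem cliqueInput_arr_eq_zero {n : ℕ} (G : SimpleGraph (Fin n)) (F a : ℕ)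
    (h : F ≠ 0 ∨ n * n ≤ a) : (cliqueInput G).arr F a = 0 := by
  refine if_neg ?_
  rintro ⟨rfl, i, j, -, rfl⟩
  have h₁ : ((i : ℕ) + 1) * n ≤ n * n := Nat.mul_le_mul_right n i.2
  rw [Nat.add_mul] at h₁
  have := j.2
  omega

/-- The running time of the reduction: if `m = O(n ^ (K + 1))` then `O(m ^ (3 - ε))` is
`O(n ^ (3 * K - 1))`, because `(K + 1) * (3 - ε) ≤ 3 * K - 1`. -/
theorem time_bound {n K m t t' D : ℕ} {C ε : ℝ} (hn : 1 ≤ n) (hε1 : ε ≤ 1) (hC : 0 ≤ C)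
    (hK : 4 ≤ ε * (K + 1)) (hm : 1 ≤ m) (hmn : m ≤ (12 * K + 26) * n ^ (K + 1))
    (ht : (t : ℝ) ≤ C * (m : ℝ) ^ (3 - ε)) (ht' : t' ≤ D * m + t) :
    (t' : ℝ) ≤ (D + C) * (12 * K + 26 : ℝ) ^ (3 - ε) * (n : ℝ) ^ (((3 * K : ℕ) : ℝ) - 1) := by
  have hm' : (1 : ℝ) ≤ m := by exact_mod_cast hm
  have hn' : (1 : ℝ) ≤ n := by exact_mod_cast hn
  have hmn' : (m : ℝ) ≤ (12 * K + 26) * (n : ℝ) ^ (K + 1) := by exact_mod_cast hmn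
  have h₁ : (m : ℝ) ≤ (m : ℝ) ^ (3 - ε) := by
    simpa using Real.rpow_le_rpow_of_exponent_le hm' (by linarith : (1 : ℝ) ≤ 3 - ε)
  have h₂ : (t' : ℝ) ≤ D * m + t := by exact_mod_cast ht'
  have h₃ : (m : ℝ) ^ (3 - ε) ≤ ((12 * K + 26) * (n : ℝ) ^ (K + 1)) ^ (3 - ε) :=
    Real.rpow_le_rpow (by positivity) hmn' (by linarith)
  have h₄ : ((n : ℝ) ^ (K + 1)) ^ (3 - ε) ≤ (n : ℝ) ^ (((3 * K : ℕ) : ℝ) - 1) := by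
    rw [← Real.rpow_natCast, ← Real.rpow_mul (by positivity)]
    refine Real.rpow_le_rpow_of_exponent_le hn' ?_
    push_cast
    linarith
  have hD : (0 : ℝ) ≤ D + C := by positivity
  calc (t' : ℝ) ≤ D * m + C * (m : ℝ) ^ (3 - ε) := by linarith
    _ ≤ D * (m : ℝ) ^ (3 - ε) + C * (m : ℝ) ^ (3 - ε) := by gcongr
    _ = (D + C) * (m : ℝ) ^ (3 - ε) := by ring
    _ ≤ (D + C) * ((12 * K + 26) * (n : ℝ) ^ (K + 1)) ^ (3 - ε) := by gcongr
    _ = (D + C) * (12 * K + 26 : ℝ) ^ (3 - ε) * ((n : ℝ) ^ (K + 1)) ^ (3 - ε) := by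
      rw [Real.mul_rpow (by positivity) (by positivity), mul_assoc]
    _ ≤ _ := by gcongr

open Classical in
/-- A fast combinatorial algorithm for the single query whether vertex `1` is reachable from
vertex `0` contradicts the clique hypothesis. -/
theorem false_of_fast_query {base : Set Prog} (hclique : CliqueHypothesis (Combinatorial base))
    {k : ℕ} (hk : 2 ≤ k) {ε : ℝ} (hε : 0 < ε) (hε1 : ε ≤ 1) {P : Prog}
    (hP : Combinatorial base P) {y c : ℕ} (hy : y ≤ 1) {C : ℝ} (hC : 0 ≤ C)
    (h : ∀ (G : LabelledGraph (Paren k)) (u v : Fin G.n), (u : ℕ) = 0 → (v : ℕ) = 1 →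
      ∃ (t : ℕ) (s : RamState), Exec ((G.n + 2) ^ c) P (graphInput G 0 y) t s ∧
        (t : ℝ) ≤ C * (G.m : ℝ) ^ (3 - ε) ∧
        s.reg 0 = if G.Reachable (dyckGrammar k).language u v then 1 else 0) : False := by
  -- The graph has `O(n ^ (K + 1))` edges; a large `K` makes the saving outweigh the extra factors.
  obtain ⟨K, hK⟩ := exists_nat_ge (4 / ε)
  rw [div_le_iff₀ hε] at hK
  have hK0 : 0 < K := by
    rcases Nat.eq_zero_or_pos K with rfl | h
    · norm_num at hK
    · exact h
  obtain ⟨eM, hM⟩ := (Expressible.const 2).mul (Expressible.numVerts K)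
  obtain ⟨eS, hS⟩ := Expressible.index.div (Expressible.const 2)
  obtain ⟨eL, hL⟩ := Expressible.edgeLab K
  obtain ⟨eT, hT⟩ := Expressible.edgeTgt hK0
  refine hclique (3 * K) (by omega) 1 one_pos ⟨P.onGraph eM eS eL eT y, hP.onGraph _ _ _ _ _,
    ((eM.passCost + eS.passCost + eL.passCost + eT.passCost + 9 : ℕ) + C) *
      (12 * K + 26 : ℝ) ^ (3 - ε),
    -- The words have to hold the values of the preprocessing as well as those of `P`.
    (eM.deg 1 + 1) * c + (eM.deg 1 + 1) + eM.deg (eM.deg 1 + 1) + eS.deg (eM.deg 1 + 1) +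
      eL.deg (eM.deg 1 + 1) + eT.deg (eM.deg 1 + 1), fun n hn G => ?_⟩
  have hmlt : 2 * numVerts n K < (n + 2) ^ (eM.deg 1 + 1) := by
    have := eM.eval_lt (n := n) (i := 0) (c := 1) (A := (cliqueInput G).arr 0) (by simp)
      (by simpa using cliqueInput_arr_lt G)
    rw [hM] at this
    exact this.trans_le (Nat.pow_le_pow_right (by omega) (Nat.le_succ _))
  have h1 := (gadgetGraph hk hn hK0 ((cliqueInput G).arr 0)).one_lt
  obtain ⟨t, s, hexec, ht, hs⟩ := h (gadgetGraph hk hn hK0 ((cliqueInput G).arr 0)).graph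
    ⟨0, by exact Nat.zero_lt_of_lt h1⟩ ⟨1, h1⟩ rfl rfl
  have hword : ((gadgetGraph hk hn hK0 ((cliqueInput G).arr 0)).graph.n + 2) ^ c ≤
      (n + 2) ^ ((eM.deg 1 + 1) * c) := by
    rw [Nat.pow_mul]
    refine Nat.pow_le_pow_left ?_ c
    have h2 : 2 ≤ numVerts n K := h1
    show numVerts n K + 2 ≤ _
    omega
  obtain ⟨t', ht', hexec'⟩ := exec_onGraph (c := eM.deg 1 + 1) (eM := eM) (eS := eS) (eL := eL)
    (eT := eT) (s := cliqueInput G) (c' := (eM.deg 1 + 1) * c + (eM.deg 1 + 1) +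
      eM.deg (eM.deg 1 + 1) + eS.deg (eM.deg 1 + 1) + eL.deg (eM.deg 1 + 1) +
      eT.deg (eM.deg 1 + 1))
    (D := gadgetGraph hk hn hK0 ((cliqueInput G).arr 0)) (n := n) (by simp [cliqueInput])
    (fun q hq => if_neg (by omega))
    (fun F a ha => cliqueInput_arr_eq_zero G F a
      (ha.imp_right fun ha => (sq_le_two_mul_numVerts hK0).trans ha))
    (fun a => (cliqueInput_arr_lt G a).trans_le (Nat.le_self_pow (Nat.succ_ne_zero _) _))
    (hM _ _ _) (fun i _ => hS _ _ _) (fun i _ => hL _ _ _) (fun i _ => hT _ _ _) hmlt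
    (by omega) (by omega) (by omega) (by omega) (by omega) hy
    (hexec.mono (hword.trans (Nat.pow_le_pow_right (by omega) (by omega))))
  refine ⟨t', s, hexec', ?_, ?_⟩
  · refine time_bound (m := (gadgetGraph hk hn hK0 ((cliqueInput G).arr 0)).graph.m) hn hε1 hC
      (by linarith) ?_ ?_ ht ht'
    · rw [TwoOut.graph_m]; omega
    · rw [TwoOut.graph_m]; exact two_mul_numVerts_le hn K
  · rw [hs]
    refine if_congr ?_ rfl rfl
    exact (TwoOut.reachable_iff _ _ _ rfl).trans (accepts_iff_exists_isNClique G hk hn hK0)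

theorem LabelledGraph.one_le_m {σ : Type} (G : LabelledGraph σ) : 1 ≤ G.m := by
  obtain ⟨e, he, -⟩ := G.no_isolated ⟨0, G.n_pos⟩
  exact List.length_pos_of_mem he

/-- A smaller saving is a weaker claim, so savings may be assumed to be at most `1`. -/
theorem mul_rpow_le {m : ℕ} (hm : 1 ≤ m) (C ε : ℝ) :
    C * (m : ℝ) ^ (3 - ε) ≤ max C 0 * (m : ℝ) ^ (3 - min ε 1) := by
  have hm' : (1 : ℝ) ≤ m := by exact_mod_cast hm
  have h₁ : (m : ℝ) ^ (3 - ε) ≤ (m : ℝ) ^ (3 - min ε 1) :=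
    Real.rpow_le_rpow_of_exponent_le hm' (by linarith [min_le_left ε 1])
  exact mul_le_mul (le_max_left _ _) h₁ (by positivity) (le_max_right _ _)

theorem mainTheorem1 (base : Set Prog) (hclique : CliqueHypothesis (Combinatorial base))
    (k : ℕ) (hk : 2 ≤ k) (ε : ℝ) (hε : 0 < ε) :
    (¬ ∃ P : Prog, Combinatorial base P ∧
        ∃ C : ℝ, SolvesOnDemandDyck k P fun m => C * (m : ℝ) ^ (3 - ε)) ∧
      (¬ ∃ P : Prog, Combinatorial base P ∧
        ∃ C : ℝ, SolvesAllPairsDyck k P fun m => C * (m : ℝ) ^ (3 - ε)) := by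
  have hε' : 0 < min ε 1 := lt_min hε one_pos
  constructor
  · rintro ⟨P, hP, C, c, h⟩
    refine false_of_fast_query hclique hk hε' (min_le_right _ _) hP (y := 1) (c := c) le_rfl
      (le_max_right C 0) fun G u v hu hv => ?_
    obtain ⟨t, s, hexec, ht, hs⟩ := h G u v
    rw [hu, hv] at hexec
    exact ⟨t, s, hexec, ht.trans (mul_rpow_le G.one_le_m C ε), hs⟩
  · rintro ⟨P, hP, C, c, h⟩
    -- Read off the entry of the pair `(0, 1)`, which is at place `1` of the table.
    refine false_of_fast_query (P := .seq P (.load 0 4 (.lit 1))) (y := 0) (c := c + 1) hclique hk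
      hε' (min_le_right _ _) (.post hP (.loopFree trivial)) zero_le_one
      (by positivity : 0 ≤ max C 0 + 1) fun G u v hu hv => ?_
    obtain ⟨t, s, hexec, ht, hs⟩ := h G
    have hs' := hs u v
    rw [hu, hv, Nat.zero_mul, Nat.zero_add] at hs'
    have hlt : s.arr 4 1 < (G.n + 2) ^ (c + 1) := by
      have : G.n + 2 ≤ (G.n + 2) ^ (c + 1) := Nat.le_self_pow (Nat.succ_ne_zero _) _
      rw [hs']
      split_ifs <;> omega
    refine ⟨t + 1, _, (hexec.mono (Nat.pow_le_pow_right (by omega) (Nat.le_succ c))).seq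
      (.load s 0 4 (.lit 1) hlt), ?_, hs'⟩
    have h₁ : (1 : ℝ) ≤ (G.m : ℝ) ^ (3 - min ε 1) :=
      Real.one_le_rpow (by exact_mod_cast G.one_le_m) (by linarith [min_le_right ε 1])
    have h₂ := ht.trans (mul_rpow_le G.one_le_m C ε)
    push_cast
    linarith
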